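/- Let $\mathcal A,\mathcal E$ be finite sets and $P=P^{A,E}$ a probability distribution on $\mathcal A\times\mathcal E$, with $P^{A|E}(a|e)=P(a,e)/P^E(e)$; logarithms are natural. For $s\ge 0$ put $\tilde H_{1+s}(A|E)=-\log\sum_{a,e}P^E(e)P^{A|E}(a|e)^{1+s}$ and $H_{1+s}(A|E)=\tilde H_{1+s}(A|E)/s$ (equal to the Shannon conditional entropy $H(A|E)$ at $s=0$). For $0\le\epsilon<1$ let $$H_{\min}^{\epsilon}(A|E|P)=\max_{\Omega:\,P(\Omega)\ge 1-\epsilon}\ \min_{(a,e)\in\Omega}-\log P^{A|E}(a|e)$$ (points of probability $0$ count as $+\infty$), $\eta(x,a)=-x\log x+xa$, and, for real $M\ge 1$, $$\overline I_{\min,M}(A|E|P)=\inf_{0<\epsilon<1/4}\Big(M e^{-H_{\min}^{\epsilon}(A|E|P)}+2\,\eta\big(2\epsilon,\log(|\mathcal A|M)\big)\Big).$$ (i) For every integer $M\ge1$ and every random function $f_X:\mathcal A\to\{1,\dots,M\}$ that is universal$_2$ (that is, $\Pr[f_X(a_1)=f_X(a_2)]\le 1/M$ for all $a_1\ne a_2$),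 $\;\mathrm E_X I(f_X(A):E)\le\overline I_{\min,M}(A|E|P)$. (ii) Let $0\le R\le H(A|E)$ and let $P^n$ be the $n$-fold i.i.d. extension of $P$. Then $$\lim_{n\to\infty}\frac{-1}{n}\log\overline I_{\min,e^{nR}}(A|E|P^n)=\sup_{R'\ge R}\min\Big\{\sup_{s\ge0}\big(\tilde H_{1+s}(A|E)-sR'\big),\,R'-R\Big\}=\sup_{s\ge 0}\frac{s}{1+s}\big(H_{1+s}(A|E)-R\big)=:W .$$ If $R<H(A|E)$, then $W\le e_I(P|R)$, where $e_I(P|R)$ is the supremum of $\liminf_n\frac{-1}{n}\log I(f_n(A_n):E_n)$, $(A_n,E_n)\sim P^n$, over all sequences $f_n:\mathcal A^n\to\{1,\dots,M_n\}$ such that $\lim_n\frac1n\log M_n$ exists and is at least $R$, and $H(f_n(A_n))/\log M_n\to1$. (iii) In the situation of (ii), $W\le V:=\max_{0\le s\le1}s\,(H_{1+s}(A|E)-R)$, the exponent obtained from the Rényi entropy of order $1+s$. The inequality is strict if $R<H(A|E)$ and $P^{A|E}(a|e)$ is not constant on $\{(a,e):P(a,e)>0\}$. -/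

import Mathlib

open Filter Topology

noncomputable section

namespace SmoothMinEntropy

/-!
A joint distribution of `(A, E)` on finite alphabets is a function `P : A × E → ℝ` lying in
`stdSimplex ℝ (A × E)`. All logarithms are natural.
-/

/-- Marginal distribution `P^A`. -/
def margA {A E : Type*} [Fintype E] (P : A × E → ℝ) (a : A) : ℝ := ∑ e, P (a, e)

/-- Marginal distribution `P^E`. -/
def margE {A E : Type*} [Fintype A] (P : A × E → ℝ) (e : E) : ℝ := ∑ a, P (a, e)

/-- Conditional probability `P^{A|E}(a|e)` at `x = (a, e)`; it is used only where `P^E(e) > 0`, or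
with the weight `P^E(e)` or `P(a, e)`. -/
def condProb {A E : Type*} [Fintype A] (P : A × E → ℝ) (x : A × E) : ℝ := P x / margE P x.2

/-- Shannon entropy `-∑ p log p`. -/
def entropy {B : Type*} [Fintype B] (p : B → ℝ) : ℝ := ∑ b, Real.negMulLog (p b)

/-- Conditional Shannon entropy `H(A|E)`. -/
def condEntropy {A E : Type*} [Fintype A] [Fintype E] (P : A × E → ℝ) : ℝ :=
  -∑ x, P x * Real.log (condProb P x)

/-- Mutual information `I(A:E) = H(A) - H(A|E)`. -/
def mutualInfo {A E : Type*} [Fintype A] [Fintype E] (P : A × E → ℝ) : ℝ :=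
  entropy (margA P) - condEntropy P

/-- `H̃_{1+s}(A|E) = -log ∑_{a,e} P^E(e) P^{A|E}(a|e)^{1+s}`. -/
def renyiTilde {A E : Type*} [Fintype A] [Fintype E] (P : A × E → ℝ) (s : ℝ) : ℝ :=
  -Real.log (∑ x : A × E, margE P x.2 * condProb P x ^ (1 + s))

/-- Conditional Rényi entropy `H_{1+s}(A|E) = H̃_{1+s}(A|E) / s`, with the limiting value `H(A|E)`
at `s = 0`. -/
def condRenyi {A E : Type*} [Fintype A] [Fintype E] (P : A × E → ℝ) (s : ℝ) : ℝ :=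
  if s = 0 then condEntropy P else renyiTilde P s / s

/-- Smooth min-entropy
`H_min^ε(A|E) = max_{Ω : P(Ω) ≥ 1 - ε} min_{(a,e) ∈ Ω} -log P^{A|E}(a|e)` for `0 ≤ ε < 1`.
Points of probability zero count as `-log 0 = +∞`, so they do not affect the minimum. -/
def smoothMinEntropy {A E : Type*} [Fintype A] [Fintype E] (P : A × E → ℝ) (ε : ℝ) : ℝ :=
  sSup {h : ℝ | ∃ Ω : Finset (A × E), 1 - ε ≤ ∑ x ∈ Ω, P x ∧
    IsLeast ((fun x => -Real.log (condProb P x)) '' {x | x ∈ Ω ∧ 0 < P x}) h}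

/-- `η(x, a) = -x log x + x a`. -/
def eta (x a : ℝ) : ℝ := -x * Real.log x + x * a

/-- The leakage bound based on smooth min-entropy:
`inf_{0 < ε < 1/4} M e^{-H_min^ε(A|E)} + 2 η(2ε, log (|A| M))`. -/
def smoothLeakageBound {A E : Type*} [Fintype A] [Fintype E] (P : A × E → ℝ) (M : ℝ) : ℝ :=
  sInf ((fun ε => M * Real.exp (-smoothMinEntropy P ε)
    + 2 * eta (2 * ε) (Real.log (Fintype.card A * M))) '' Set.Ioo 0 (1 / 4))

/-- The `n`-fold i.i.d. extension of `P`. -/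
def iidDist {A E : Type*} (P : A × E → ℝ) (n : ℕ) : (Fin n → A) × (Fin n → E) → ℝ :=
  fun x => ∏ i, P (x.1 i, x.2 i)

/-- Joint distribution of `(f(A), E)`. -/
def hashDist {A E : Type*} [Fintype A] {M : ℕ} (P : A × E → ℝ) (f : A → Fin M) :
    Fin M × E → ℝ :=
  fun y => ∑ a with f a = y.1, P (a, y.2)

/-- A random function `f : A → {1, …, M}` with law `q` is universal₂: distinct points collide with
probability at most `1 / M`. -/
def IsUniversalTwo {A : Type*} [Fintype A] [DecidableEq A] {M : ℕ} (q : (A → Fin M) → ℝ) : Prop :=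
  q ∈ stdSimplex ℝ (A → Fin M) ∧
    ∀ a₁ a₂ : A, a₁ ≠ a₂ → ∑ f with f a₁ = f a₂, q f ≤ 1 / (M : ℝ)

/-- Expected information `E_X I(f_X(A) : E)` of Eve about the hashed value. -/
def expectedLeakage {A E : Type*} [Fintype A] [DecidableEq A] [Fintype E] {M : ℕ}
    (P : A × E → ℝ) (q : (A → Fin M) → ℝ) : ℝ :=
  ∑ f, q f * mutualInfo (hashDist P f)

/-- Optimal exponent of Eve's information at key rate `R`: the supremum of
`liminf -(1/n) log I(f_n(A_n) : E_n)` (with `-log 0 = +∞`) over the sequences of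
`f_n : A^n → {1, …, M_n}` whose rate `lim (1/n) log M_n` is at least `R` and whose output is
asymptotically uniform, `H(f_n(A_n)) / log M_n → 1`. -/
def leakageExponent {A E : Type*} [Fintype A] [Fintype E] (P : A × E → ℝ) (R : ℝ) : EReal :=
  sSup {x : EReal | ∃ (M : ℕ → ℕ) (f : ∀ n, (Fin n → A) → Fin (M n)) (r : ℝ),
    Tendsto (fun n => Real.log (M n) / n) atTop (𝓝 r) ∧ R ≤ r ∧
    Tendsto (fun n => entropy (margA (hashDist (iidDist P n) (f n))) / Real.log (M n))
      atTop (𝓝 1) ∧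
    x = liminf (fun n : ℕ =>
      -ENNReal.log (ENNReal.ofReal (mutualInfo (hashDist (iidDist P n) (f n)))) / (n : EReal))
      atTop}

end SmoothMinEntropy

end

/-!
Jensen's inequality bounds the leakage of a universal₂ family by `∑ P log (1 + M P^{A|E})`. Cutting
this sum at `exp (-H_min^ε)`, the upper `ε`-quantile of `P^{A|E}`, gives (i).

For `P^n` and `ε = e^{-nc}`, Chernoff's bound and Cramér's lower bound for the sum of the
`log P^{A|E}` locate that quantile on the exponential scale, and balancing it against `ε` gives `W`.

Since `s ↦ renyiTilde P s` is concave and vanishes at `0`, the term of `W` at `s` is at most the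
term of `V` at `s / (1 + s) ≤ 1`. The same leakage bound with `log (1 + x) ≤ x^s / s` and a
uniformly random function shows `V ≤ e_I`.
-/

namespace SmoothMinEntropy

section RealAnalysis

lemma mul_sub_nonpos_of_isMaxOn {f : ℝ → ℝ} {S : Set ℝ} {a b d : ℝ} (hS : Convex ℝ S)
    (hmax : IsMaxOn f S a) (hf : HasDerivAt f d a) (ha : a ∈ S) (hb : b ∈ S) :
    d * (b - a) ≤ 0 := by
  simpa [mul_comm] using hmax.localize.hasFDerivWithinAt_nonpos
    hf.hasFDerivAt.hasFDerivWithinAt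
    (sub_mem_posTangentConeAt_of_segment_subset (hS.segment_subset ha hb))

lemma exists_lt_forall_le_of_eventually_le {f : ℝ → ℝ} {a m V : ℝ}
    (hf : ContinuousOn f (Set.Ici a)) (hlt : ∀ s, a ≤ s → f s < V) (hm : m < V)
    (hev : ∀ᶠ s in atTop, f s ≤ m) : ∃ w < V, ∀ s, a ≤ s → f s ≤ w := by
  obtain ⟨S, hS⟩ := eventually_atTop.1 hev
  obtain ⟨u, hu, hmax⟩ := isCompact_Icc.exists_isMaxOn (Set.nonempty_Icc.2 (le_max_left a S))
    (hf.mono Set.Icc_subset_Ici_self)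
  refine ⟨max m (f u), max_lt hm (hlt u hu.1), fun s hs => ?_⟩
  rcases le_total s (max a S) with h | h
  · exact (hmax ⟨hs, h⟩).trans (le_max_right _ _)
  · exact (hS s ((le_max_right a S).trans h)).trans (le_max_left _ _)

lemma tendsto_exp_neg_natCast_mul {v : ℝ} (hv : 0 < v) :
    Tendsto (fun n : ℕ => Real.exp (-(n * v))) atTop (𝓝 0) :=
  Real.tendsto_exp_neg_atTop_nhds_zero.comp (tendsto_natCast_atTop_atTop.atTop_mul_const hv)

lemma eventually_one_add_mul_le_exp (C : ℝ) {δ : ℝ} (hδ : 0 < δ) :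
    ∀ᶠ n : ℕ in atTop, 1 + C * n ≤ Real.exp (n * δ) := by
  filter_upwards [eventually_ge_atTop ⌈2 * C / δ ^ 2⌉₊] with n hn
  have hC : 2 * C ≤ n * δ ^ 2 := (div_le_iff₀ (by positivity)).1 (Nat.ceil_le.1 hn)
  have hn0 : (0 : ℝ) ≤ n := n.cast_nonneg
  have hnδ : 0 ≤ n * δ := mul_nonneg hn0 hδ.le
  nlinarith [Real.quadratic_le_exp_of_nonneg hnδ, mul_le_mul_of_nonneg_left hC hn0]

lemma tendsto_neg_div_mul_log {b : ℕ → ℝ} {W : ℝ}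
    (hlo : ∀ δ > 0, ∀ᶠ n : ℕ in atTop, Real.exp (-(n * (W + δ))) ≤ b n)
    (hup : ∀ δ > 0, ∀ᶠ n : ℕ in atTop, b n ≤ Real.exp (-(n * (W - δ)))) :
    Tendsto (fun n : ℕ => -(1 / (n : ℝ)) * Real.log (b n)) atTop (𝓝 W) := by
  refine Metric.tendsto_nhds.2 fun δ hδ => ?_
  filter_upwards [hlo _ (half_pos hδ), hup _ (half_pos hδ), eventually_gt_atTop 0]
    with n hlower hupper hn
  have hn0 : (0 : ℝ) < n := by exact_mod_cast hn
  have hb : 0 < b n := (Real.exp_pos _).trans_le hlower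
  rw [← Real.le_log_iff_exp_le hb] at hlower
  rw [← Real.log_le_iff_le_exp hb] at hupper
  have hle : -Real.log (b n) / n ≤ W + δ / 2 := (div_le_iff₀ hn0).2 (by linarith)
  have hge : W - δ / 2 ≤ -Real.log (b n) / n := (le_div_iff₀ hn0).2 (by linarith)
  have heq : -(1 / (n : ℝ)) * Real.log (b n) = -Real.log (b n) / n := by ring
  rw [heq, Real.dist_eq, abs_lt]
  constructor <;> linarith

lemma le_liminf_neg_log_div {I : ℕ → ℝ} {C v : ℝ} (hC : 0 < C)
    (hI : ∀ n : ℕ, I n ≤ C * Real.exp (-(n * v))) :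
    (v : EReal) ≤
      liminf (fun n : ℕ => -ENNReal.log (ENNReal.ofReal (I n)) / (n : EReal)) atTop := by
  have hlim : Tendsto (fun n : ℕ => ((v - Real.log C / n : ℝ) : EReal)) atTop (𝓝 (v : EReal)) := by
    refine (continuous_coe_real_ereal.tendsto v).comp ?_
    simpa using (tendsto_const_div_atTop_nhds_zero_nat (Real.log C)).const_sub v
  rw [← hlim.liminf_eq]
  refine liminf_le_liminf ?_
  filter_upwards [eventually_gt_atTop 0] with n hn
  have hn0 : (n : ℝ) ≠ 0 := by exact_mod_cast hn.ne'
  have hlog : ENNReal.log (ENNReal.ofReal (I n)) ≤ ((Real.log C - n * v : ℝ) : EReal) := by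
    refine (ENNReal.log_le_log (ENNReal.ofReal_le_ofReal (hI n))).trans_eq ?_
    rw [ENNReal.log_ofReal_of_pos (by positivity), Real.log_mul hC.ne' (Real.exp_pos _).ne',
      Real.log_exp, sub_eq_add_neg]
  have hdiv : v - Real.log C / n = -(Real.log C - n * v) / n := by
    field_simp
    ring
  rw [hdiv, EReal.coe_div, EReal.coe_neg]
  exact EReal.div_le_div_right_of_nonneg (by simp) (EReal.neg_le_neg_iff.2 hlog)

/-- Both suprema are governed by the crossing point of the lines `R' ↦ φ s - s R'` and
`R' ↦ R' - R`, which lies at height `(φ s - s R) / (1 + s)`. -/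
lemma coe_eq_iSup_min_of_isLUB {φ : ℝ → ℝ} (hφ : 0 ≤ φ 0) {R W : ℝ}
    (hW : IsLUB ((fun s : ℝ => (φ s - s * R) / (1 + s)) '' Set.Ici 0) W) :
    (W : EReal) = ⨆ (R' : ℝ) (_ : R ≤ R'),
      min (⨆ (s : ℝ) (_ : 0 ≤ s), ((φ s - s * R' : ℝ) : EReal)) ((R' - R : ℝ) : EReal) := by
  apply le_antisymm
  · refine EReal.ge_of_forall_gt_iff_ge.1 fun w hw => ?_
    obtain ⟨_, ⟨s, hs, rfl⟩, hws, -⟩ := hW.exists_between (EReal.coe_lt_coe_iff.1 hw)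
    change w < (φ s - s * R) / (1 + s) at hws
    have hs0 : (0 : ℝ) ≤ s := hs
    rw [lt_div_iff₀ (by linarith)] at hws
    rcases le_total 0 w with h0 | h0
    · refine le_iSup₂_of_le (R + w) (by linarith) (le_min ?_ ?_)
      · exact le_iSup₂_of_le s hs0 (EReal.coe_le_coe_iff.2 (by linarith))
      · exact EReal.coe_le_coe_iff.2 (by linarith)
    · refine le_iSup₂_of_le R le_rfl (le_min ?_ ?_)
      · exact le_iSup₂_of_le 0 le_rfl (EReal.coe_le_coe_iff.2 (by linarith))
      · exact EReal.coe_le_coe_iff.2 (by linarith)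
  · refine iSup₂_le fun R' _ => ?_
    rcases le_total (R' - R) W with h | h
    · exact (min_le_right _ _).trans (EReal.coe_le_coe_iff.2 h)
    · refine (min_le_left _ _).trans (iSup₂_le fun s hs => EReal.coe_le_coe_iff.2 ?_)
      have hle : (φ s - s * R) / (1 + s) ≤ W := hW.1 ⟨s, hs, rfl⟩
      rw [div_le_iff₀ (by linarith)] at hle
      nlinarith [mul_le_mul_of_nonneg_left h hs]

end RealAnalysis

section ExponentialMoments

variable {ι : Type*} [Fintype ι] {p : ι → ℝ} (L : ι → ℝ)

lemma exists_pos_of_mem_stdSimplex (hp : p ∈ stdSimplex ℝ ι) : ∃ x, 0 < p x := by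
  obtain ⟨x, -, hx⟩ := Finset.exists_lt_of_sum_lt (s := Finset.univ) (f := fun _ => 0) (g := p)
    (by simp [hp.2])
  exact ⟨x, hx⟩

lemma sum_compl_le_iff [DecidableEq ι] (hp : p ∈ stdSimplex ℝ ι) {Ω : Finset ι} {ε : ℝ} :
    ∑ x ∈ Ωᶜ, p x ≤ ε ↔ 1 - ε ≤ ∑ x ∈ Ω, p x := by
  have := Finset.sum_add_sum_compl Ω p
  rw [hp.2] at this
  constructor <;> intro h <;> linarith

lemma prod_mem_stdSimplex (hp : p ∈ stdSimplex ℝ ι) (n : ℕ) :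
    (fun x : Fin n → ι => ∏ i, p (x i)) ∈ stdSimplex ℝ (Fin n → ι) :=
  ⟨fun x => Finset.prod_nonneg fun i _ => hp.1 (x i), by rw [← Fintype.sum_pow, hp.2, one_pow]⟩

/-- Exponential moment `∑ p exp (s L)` of `L` under the weights `p`. -/
noncomputable def expMoment (p L : ι → ℝ) (s : ℝ) : ℝ := ∑ x, p x * Real.exp (s * L x)

/-- The weights `p exp (s L)`, normalized: the change of measure of Cramér's theorem. -/
noncomputable def tilt (p L : ι → ℝ) (s : ℝ) (x : ι) : ℝ :=
  p x * Real.exp (s * L x) / expMoment p L s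

/-- Weight, under the product weights `p^n`, of the event that the empirical mean of `L` is at
least `t`. It is stated for the sum of `L`, so that it is everything when `n = 0`. -/
noncomputable def upperTail (p L : ι → ℝ) (n : ℕ) (t : ℝ) : ℝ :=
  ∑ x : Fin n → ι with n * t ≤ ∑ i, L (x i), ∏ i, p (x i)

lemma expMoment_pos (hp : p ∈ stdSimplex ℝ ι) (s : ℝ) : 0 < expMoment p L s := by
  obtain ⟨x, hx⟩ := exists_pos_of_mem_stdSimplex hp
  exact Finset.sum_pos' (fun y _ => mul_nonneg (hp.1 y) (Real.exp_pos _).le)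
    ⟨x, Finset.mem_univ x, mul_pos hx (Real.exp_pos _)⟩

lemma expMoment_zero (hp : p ∈ stdSimplex ℝ ι) : expMoment p L 0 = 1 := by
  simp [expMoment, hp.2]

lemma tilt_zero (hp : p ∈ stdSimplex ℝ ι) : tilt p L 0 = p := by
  ext x
  simp [tilt, expMoment_zero L hp]

lemma tilt_mem_stdSimplex (hp : p ∈ stdSimplex ℝ ι) (s : ℝ) : tilt p L s ∈ stdSimplex ℝ ι :=
  ⟨fun x => div_nonneg (mul_nonneg (hp.1 x) (Real.exp_pos _).le) (expMoment_pos L hp s).le, by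
    simp only [tilt]
    rw [← Finset.sum_div]
    exact div_self (expMoment_pos L hp s).ne'⟩

lemma prod_eq_prod_tilt_mul_exp (hp : p ∈ stdSimplex ℝ ι) (s : ℝ) {n : ℕ} (x : Fin n → ι) :
    ∏ i, p (x i) =
      (∏ i, tilt p L s (x i)) * Real.exp (n * Real.log (expMoment p L s) - s * ∑ i, L (x i)) := by
  have hZ := expMoment_pos L hp s
  simp only [tilt, Finset.prod_div_distrib, Finset.prod_mul_distrib, Finset.prod_const,
    Finset.card_univ, Fintype.card_fin]
  rw [Real.exp_sub, Real.exp_nat_mul, Real.exp_log hZ, Finset.mul_sum, Real.exp_sum]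
  have hprod : ∏ i, Real.exp (s * L (x i)) ≠ 0 :=
    Finset.prod_ne_zero_iff.2 fun i _ => (Real.exp_pos _).ne'
  field_simp

lemma hasDerivAt_log_expMoment (hp : p ∈ stdSimplex ℝ ι) (s : ℝ) :
    HasDerivAt (fun s => Real.log (expMoment p L s)) (∑ x, tilt p L s x * L x) s := by
  have hZ : HasDerivAt (expMoment p L) (∑ x, p x * (Real.exp (s * L x) * L x)) s := by
    unfold expMoment
    refine HasDerivAt.fun_sum fun x _ => ?_
    exact (((hasDerivAt_id s).mul_const (L x)).exp.const_mul (p x)).congr_deriv (by simp)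
  refine (hZ.log (expMoment_pos L hp s).ne').congr_deriv ?_
  rw [Finset.sum_div]
  exact Finset.sum_congr rfl fun x _ => by rw [tilt]; ring

lemma continuous_log_expMoment (hp : p ∈ stdSimplex ℝ ι) :
    Continuous fun s => Real.log (expMoment p L s) :=
  continuous_iff_continuousAt.2 fun s => (hasDerivAt_log_expMoment L hp s).continuousAt

lemma hasDerivAt_mul_sub_log_expMoment (hp : p ∈ stdSimplex ℝ ι) (t s : ℝ) :
    HasDerivAt (fun s => s * t - Real.log (expMoment p L s)) (t - ∑ x, tilt p L s x * L x) s :=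
  (((hasDerivAt_id' s).mul_const t).fun_sub (hasDerivAt_log_expMoment L hp s)).congr_deriv
    (by simp)

variable {L}

lemma exists_log_expMoment_lt_mul (hp : p ∈ stdSimplex ℝ ι) {t : ℝ} (ht : ∑ x, p x * L x < t) :
    ∃ s, 0 < s ∧ s ≤ 1 ∧ Real.log (expMoment p L s) < s * t := by
  by_contra! h
  have hmax : IsMaxOn (fun s => s * t - Real.log (expMoment p L s)) (Set.Icc 0 1) 0 := by
    rintro s ⟨h0, h1⟩
    rcases h0.eq_or_lt with rfl | h0
    · exact le_refl (0 * t - Real.log (expMoment p L 0))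
    · simpa [expMoment_zero L hp] using h s h0 h1
  have := mul_sub_nonpos_of_isMaxOn (convex_Icc 0 1) hmax
    (hasDerivAt_mul_sub_log_expMoment L hp t 0) (Set.left_mem_Icc.2 zero_le_one)
    (Set.right_mem_Icc.2 zero_le_one)
  rw [tilt_zero L hp] at this
  linarith

lemma upperTail_le_pow (hp : ∀ x, 0 ≤ p x) (L : ι → ℝ) (n : ℕ) (t : ℝ) {s : ℝ} (hs : 0 ≤ s) :
    upperTail p L n t ≤ (Real.exp (-(s * t)) * expMoment p L s) ^ n := by
  have hpow : (Real.exp (-(s * t)) * expMoment p L s) ^ n =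
      ∑ x : Fin n → ι, ∏ i, p (x i) * Real.exp (s * (L (x i) - t)) := by
    rw [← Fintype.sum_pow (fun x => p x * Real.exp (s * (L x - t))), expMoment, Finset.mul_sum]
    congr 1
    refine Finset.sum_congr rfl fun x _ => ?_
    rw [mul_left_comm, ← Real.exp_add]
    ring_nf
  calc upperTail p L n t
      ≤ ∑ x : Fin n → ι with n * t ≤ ∑ i, L (x i),
          ∏ i, p (x i) * Real.exp (s * (L (x i) - t)) := by
        refine Finset.sum_le_sum fun x hx => ?_
        have hLx := (Finset.mem_filter.1 hx).2
        rw [Finset.prod_mul_distrib, ← Real.exp_sum, ← Finset.mul_sum, Finset.sum_sub_distrib]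
        refine le_mul_of_one_le_right (Finset.prod_nonneg fun i _ => hp (x i))
          (Real.one_le_exp (mul_nonneg hs ?_))
        simpa using hLx
    _ ≤ ∑ x : Fin n → ι, ∏ i, p (x i) * Real.exp (s * (L (x i) - t)) :=
        Finset.sum_le_sum_of_subset_of_nonneg (Finset.filter_subset _ _) fun x _ _ =>
          Finset.prod_nonneg fun i _ => mul_nonneg (hp (x i)) (Real.exp_pos _).le
    _ = (Real.exp (-(s * t)) * expMoment p L s) ^ n := hpow.symm

lemma upperTail_le_exp (hp : p ∈ stdSimplex ℝ ι) (L : ι → ℝ) (n : ℕ) (t : ℝ) {s : ℝ}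
    (hs : 0 ≤ s) :
    upperTail p L n t ≤ Real.exp (-(n * (s * t - Real.log (expMoment p L s)))) := by
  refine (upperTail_le_pow hp.1 L n t hs).trans_eq ?_
  rw [← mul_neg (n : ℝ), Real.exp_nat_mul, neg_sub, sub_eq_neg_add, Real.exp_add,
    Real.exp_log (expMoment_pos L hp s)]

lemma tendsto_upperTail_zero (hp : p ∈ stdSimplex ℝ ι) {t : ℝ} (ht : ∑ x, p x * L x < t) :
    Tendsto (fun n => upperTail p L n t) atTop (𝓝 0) := by
  obtain ⟨s, h0, -, hs⟩ := exists_log_expMoment_lt_mul hp ht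
  exact squeeze_zero (fun n => Finset.sum_nonneg fun x _ => (prod_mem_stdSimplex hp n).1 x)
    (fun n => upperTail_le_exp hp L n t h0.le) (tendsto_exp_neg_natCast_mul (sub_pos.2 hs))

lemma tendsto_sum_prod_abs_sub_lt (hp : p ∈ stdSimplex ℝ ι) (L : ι → ℝ) {δ : ℝ} (hδ : 0 < δ) :
    Tendsto (fun n : ℕ => ∑ x : Fin n → ι with |∑ i, L (x i) - n * ∑ x, p x * L x| < n * δ,
      ∏ i, p (x i)) atTop (𝓝 1) := by
  set μ := ∑ x, p x * L x
  have hup : Tendsto (fun n => upperTail p L n (μ + δ)) atTop (𝓝 0) :=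
    tendsto_upperTail_zero hp (lt_add_of_pos_right μ hδ)
  have hlo : Tendsto (fun n => upperTail p (-L) n (-μ + δ)) atTop (𝓝 0) := by
    refine tendsto_upperTail_zero hp ?_
    simp only [Pi.neg_apply, mul_neg, Finset.sum_neg_distrib]
    exact lt_add_of_pos_right (-μ) hδ
  have hlim : Tendsto (fun n => 1 - (upperTail p L n (μ + δ) + upperTail p (-L) n (-μ + δ)))
      atTop (𝓝 1) := by
    simpa using (hup.add hlo).const_sub 1
  refine tendsto_of_tendsto_of_tendsto_of_le_of_le hlim tendsto_const_nhds (fun n => ?_)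
    fun n => ?_
  · have hpn := prod_mem_stdSimplex hp n
    rw [sub_le_iff_le_add, ← hpn.2, upperTail, upperTail, Finset.sum_filter, Finset.sum_filter,
      Finset.sum_filter, ← Finset.sum_add_distrib, ← Finset.sum_add_distrib]
    refine Finset.sum_le_sum fun x _ => ?_
    have hx := hpn.1 x
    by_cases hdev : |∑ i, L (x i) - n * μ| < n * δ
    · rw [if_pos hdev]
      have := hpn.1 x
      split_ifs <;> linarith
    · rcases le_abs.1 (not_lt.1 hdev) with h | h
      · rw [if_pos (c := n * (μ + δ) ≤ _) (by linarith)]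
        split_ifs <;> linarith
      · rw [if_pos (c := n * (-μ + δ) ≤ _) (by
          simp only [Pi.neg_apply, Finset.sum_neg_distrib]; linarith)]
        split_ifs <;> linarith
  · rw [← (prod_mem_stdSimplex hp n).2]
    exact Finset.sum_le_sum_of_subset_of_nonneg (Finset.filter_subset _ _)
      fun x _ _ => (prod_mem_stdSimplex hp n).1 x

lemma exists_isMaxOn_mul_sub_log_expMoment (hp : p ∈ stdSimplex ℝ ι) {v u W : ℝ} (hvu : v < u)
    (hW : ∀ s, 0 ≤ s → s * u - Real.log (expMoment p L s) ≤ W) :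
    ∃ s ∈ Set.Ici 0, IsMaxOn (fun s => s * v - Real.log (expMoment p L s)) (Set.Ici 0) s := by
  have hcont : Continuous fun s => s * v - Real.log (expMoment p L s) :=
    (continuous_id.mul continuous_const).sub (continuous_log_expMoment L hp)
  refine hcont.continuousOn.exists_isMaxOn' isClosed_Ici Set.self_mem_Ici ?_
  filter_upwards [mem_inf_of_left
    (isCompact_Icc (a := 0) (b := W / (u - v))).compl_mem_cocompact,
    mem_inf_of_right (mem_principal_self (Set.Ici (0 : ℝ)))] with s hs hs0
  have hlarge : W < s * (u - v) := by
    rw [← div_lt_iff₀ (sub_pos.2 hvu)]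
    exact not_le.1 fun h => hs ⟨hs0, h⟩
  have := hW s hs0
  simp only [zero_mul, expMoment_zero L hp, Real.log_one, sub_zero]
  linarith

lemma exists_le_sum_tilt_mul (hp : p ∈ stdSimplex ℝ ι) {v u W : ℝ} (hvu : v < u)
    (hW : ∀ s, 0 ≤ s → s * u - Real.log (expMoment p L s) ≤ W) :
    ∃ s, 0 ≤ s ∧ v ≤ ∑ x, tilt p L s x * L x ∧ s * ∑ x, tilt p L s x * L x = s * v := by
  obtain ⟨s, hs, hmax⟩ := exists_isMaxOn_mul_sub_log_expMoment hp hvu hW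
  have hs0 : 0 ≤ s := hs
  have hder {b : ℝ} (hb : 0 ≤ b) : (v - ∑ x, tilt p L s x * L x) * (b - s) ≤ 0 :=
    mul_sub_nonpos_of_isMaxOn (convex_Ici 0) hmax (hasDerivAt_mul_sub_log_expMoment L hp v s) hs hb
  have hle : v ≤ ∑ x, tilt p L s x * L x := by linarith [hder (by linarith : 0 ≤ s + 1)]
  refine ⟨s, hs0, hle, ?_⟩
  nlinarith [hder le_rfl, mul_nonneg hs0 (sub_nonneg.2 hle)]

/-- Lower bound of Cramér's theorem: after tilting the weights so that their mean lies between
`t` and `u`, the law of large numbers makes the event typical. -/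
lemma eventually_exp_le_upperTail (hp : p ∈ stdSimplex ℝ ι) {t u W : ℝ} (htu : t < u)
    (hW : ∀ s, 0 ≤ s → s * u - Real.log (expMoment p L s) ≤ W) :
    ∀ᶠ n : ℕ in atTop, 1 / 2 * Real.exp (-(n * W)) ≤ upperTail p L n t := by
  obtain ⟨s, hs, hmean, hcrit⟩ := exists_le_sum_tilt_mul hp (v := (t + u) / 2) (by linarith) hW
  have hq := tilt_mem_stdSimplex L hp s
  have hlaw := tendsto_sum_prod_abs_sub_lt hq L (half_pos (sub_pos.2 htu))
  filter_upwards [hlaw.eventually_const_le one_half_lt_one] with n hn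
  set μ := ∑ x, tilt p L s x * L x
  have hn0 : (0 : ℝ) ≤ n := n.cast_nonneg
  calc 1 / 2 * Real.exp (-(n * W))
      ≤ ∑ x : Fin n → ι with |∑ i, L (x i) - n * μ| < n * ((u - t) / 2),
          (∏ i, tilt p L s (x i)) * Real.exp (-(n * W)) := by
        rw [← Finset.sum_mul]
        gcongr
    _ ≤ ∑ x : Fin n → ι with |∑ i, L (x i) - n * μ| < n * ((u - t) / 2), ∏ i, p (x i) := by
        refine Finset.sum_le_sum fun x hx => ?_
        have hlt := (abs_lt.1 (Finset.mem_filter.1 hx).2).2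
        rw [prod_eq_prod_tilt_mul_exp L hp s x]
        refine mul_le_mul_of_nonneg_left (Real.exp_le_exp.2 ?_) ((prod_mem_stdSimplex hq n).1 x)
        nlinarith [mul_le_mul_of_nonneg_left hlt.le hs,
          mul_le_mul_of_nonneg_left (hW s hs) hn0, congrArg ((n : ℝ) * ·) hcrit]
    _ ≤ upperTail p L n t := by
        refine Finset.sum_le_sum_of_subset_of_nonneg (fun x hx => ?_)
          fun x _ _ => (prod_mem_stdSimplex hp n).1 x
        have hgt := (abs_lt.1 (Finset.mem_filter.1 hx).2).1
        refine Finset.mem_filter.2 ⟨Finset.mem_univ x, ?_⟩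
        nlinarith [mul_le_mul_of_nonneg_left hmean hn0]

lemma expMoment_mul (p L : ι → ℝ) (θ s : ℝ) :
    expMoment p L (θ * s) = ∑ x, p x * Real.exp (s * L x) ^ θ :=
  Finset.sum_congr rfl fun x _ => by rw [← Real.exp_mul]; ring_nf

lemma log_expMoment_mul_le (hp : p ∈ stdSimplex ℝ ι) (L : ι → ℝ) (s : ℝ) {θ : ℝ} (h0 : 0 ≤ θ)
    (h1 : θ ≤ 1) :
    Real.log (expMoment p L (θ * s)) ≤ θ * Real.log (expMoment p L s) := by
  have hJensen := (Real.concaveOn_rpow h0 h1).le_map_sum (t := Finset.univ) (w := p)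
    (p := fun x => Real.exp (s * L x)) (fun x _ => hp.1 x) hp.2 fun x _ => (Real.exp_pos _).le
  simp only [smul_eq_mul, ← expMoment_mul] at hJensen
  rw [← Real.log_rpow (expMoment_pos L hp s)]
  exact Real.log_le_log (expMoment_pos L hp _) hJensen

lemma log_expMoment_mul_lt (hp : p ∈ stdSimplex ℝ ι) {s θ : ℝ} (hs : s ≠ 0) (h0 : 0 < θ)
    (h1 : θ < 1) {x y : ι} (hx : 0 < p x) (hy : 0 < p y) (hxy : L x ≠ L y) :
    Real.log (expMoment p L (θ * s)) < θ * Real.log (expMoment p L s) := by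
  have hexp : Real.exp (s * L x) ≠ Real.exp (s * L y) := fun h =>
    hxy (mul_left_cancel₀ hs (Real.exp_injective h))
  have hJensen := ((Real.strictConcaveOn_rpow h0 h1).lt_map_sum_iff_of_nonneg
    (t := Finset.univ) (w := p) (p := fun x => Real.exp (s * L x)) (fun x _ => hp.1 x) hp.2
    fun x _ => (Real.exp_pos _).le).2
    ⟨x, Finset.mem_univ x, y, Finset.mem_univ y, hx.ne', hy.ne', hexp⟩
  simp only [smul_eq_mul, ← expMoment_mul] at hJensen
  rw [← Real.log_rpow (expMoment_pos L hp s)]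
  exact Real.log_lt_log (expMoment_pos L hp _) hJensen

lemma log_add_mul_le_log_expMoment (hp : ∀ x, 0 ≤ p x) (L : ι → ℝ) (s : ℝ) {z : ι}
    (hz : 0 < p z) : Real.log (p z) + s * L z ≤ Real.log (expMoment p L s) := by
  rw [← Real.log_exp (s * L z), ← Real.log_mul hz.ne' (Real.exp_pos _).ne']
  exact Real.log_le_log (by positivity) (Finset.single_le_sum
    (f := fun v => p v * Real.exp (s * L v))
    (fun v _ => mul_nonneg (hp v) (Real.exp_pos _).le) (Finset.mem_univ z))

lemma log_expMoment_lt_mul (hp : p ∈ stdSimplex ℝ ι) {s b : ℝ} (hs : 0 < s)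
    (hle : ∀ x, 0 < p x → L x ≤ b) {w : ι} (hw : 0 < p w) (hlt : L w < b) :
    Real.log (expMoment p L s) < s * b := by
  rw [Real.log_lt_iff_lt_exp (expMoment_pos L hp s)]
  calc expMoment p L s < ∑ v, p v * Real.exp (s * b) := by
        refine Finset.sum_lt_sum (fun v _ => ?_) ⟨w, Finset.mem_univ w, by gcongr⟩
        rcases (hp.1 v).eq_or_lt with h | h
        · simp [← h]
        · have := hle v h
          gcongr
    _ = Real.exp (s * b) := by rw [← Finset.sum_mul, hp.2, one_mul]

lemma exists_log_expMoment_one_lt_slope (hp : p ∈ stdSimplex ℝ ι) {x y : ι} (hx : 0 < p x)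
    (hy : 0 < p y) (hxy : L x ≠ L y) :
    ∃ b c, Real.log (expMoment p L 1) < b ∧ ∀ s, c + s * b ≤ Real.log (expMoment p L s) := by
  obtain ⟨z, hz, hmax⟩ := Finset.exists_max_image ({x | 0 < p x} : Finset ι) L
    ⟨x, by simpa using hx⟩
  simp only [Finset.mem_filter, Finset.mem_univ, true_and] at hz hmax
  obtain ⟨w, hw, hlt⟩ : ∃ w, 0 < p w ∧ L w < L z := by
    rcases (hmax x hx).lt_or_eq with h | h
    · exact ⟨x, hx, h⟩
    · exact ⟨y, hy, (hmax y hy).lt_of_ne fun h' => hxy (h.trans h'.symm)⟩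
  exact ⟨L z, Real.log (p z), by simpa using log_expMoment_lt_mul hp one_pos hmax hw hlt,
    fun s => log_add_mul_le_log_expMoment hp.1 L s hz⟩

end ExponentialMoments

section Hashing

variable {A E : Type*} [Fintype A] {P : A × E → ℝ}

lemma le_margE (hP : ∀ x, 0 ≤ P x) (x : A × E) : P x ≤ margE P x.2 :=
  Finset.single_le_sum (f := fun a => P (a, x.2)) (fun a _ => hP (a, x.2)) (Finset.mem_univ x.1)

lemma margE_nonneg (hP : ∀ x, 0 ≤ P x) (e : E) : 0 ≤ margE P e :=
  Finset.sum_nonneg fun a _ => hP (a, e)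

lemma condProb_nonneg (hP : ∀ x, 0 ≤ P x) (x : A × E) : 0 ≤ condProb P x :=
  div_nonneg (hP x) (margE_nonneg hP x.2)

lemma condProb_le_one (hP : ∀ x, 0 ≤ P x) (x : A × E) : condProb P x ≤ 1 :=
  div_le_one_of_le₀ (le_margE hP x) (margE_nonneg hP x.2)

lemma condProb_pos (hP : ∀ x, 0 ≤ P x) {x : A × E} (hx : 0 < P x) : 0 < condProb P x :=
  div_pos hx (hx.trans_le (le_margE hP x))

lemma margE_mul_condProb (hP : ∀ x, 0 ≤ P x) (x : A × E) : margE P x.2 * condProb P x = P x :=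
  mul_div_cancel_of_imp' fun h => le_antisymm (h ▸ le_margE hP x) (hP x)

lemma margE_hashDist {M : ℕ} (P : A × E → ℝ) (f : A → Fin M) (e : E) :
    margE (hashDist P f) e = margE P e :=
  Finset.sum_fiberwise Finset.univ f fun a => P (a, e)

lemma le_hashDist (hP : ∀ x, 0 ≤ P x) {M : ℕ} (f : A → Fin M) (x : A × E) :
    P x ≤ hashDist P f (f x.1, x.2) :=
  Finset.single_le_sum (f := fun a => P (a, x.2)) (fun a _ => hP (a, x.2))
    (Finset.mem_filter.2 ⟨Finset.mem_univ x.1, rfl⟩)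

lemma sum_mul_hashDist_eq {M : ℕ} (P : A × E → ℝ) (q : (A → Fin M) → ℝ) [DecidableEq A]
    (x : A × E) :
    ∑ f, q f * hashDist P f (f x.1, x.2) = ∑ a, P (a, x.2) * ∑ f with f a = f x.1, q f := by
  simp_rw [hashDist, Finset.sum_filter, Finset.mul_sum]
  rw [Finset.sum_comm]
  refine Finset.sum_congr rfl fun a _ => Finset.sum_congr rfl fun f _ => ?_
  split_ifs <;> ring

lemma sum_mul_hashDist_le [DecidableEq A] (hP : ∀ x, 0 ≤ P x) {M : ℕ} {q : (A → Fin M) → ℝ}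
    (hq : IsUniversalTwo q) (x : A × E) :
    ∑ f, q f * hashDist P f (f x.1, x.2) ≤ P x + margE P x.2 * (1 / M) := by
  have hsingle : P x = ∑ a, if a = x.1 then P (a, x.2) else 0 := by simp
  rw [sum_mul_hashDist_eq, hsingle, margE, Finset.sum_mul, ← Finset.sum_add_distrib]
  refine Finset.sum_le_sum fun a _ => ?_
  have hPa := hP (a, x.2)
  split_ifs with ha
  · have hq1 : ∑ f with f a = f x.1, q f ≤ 1 := by
      rw [← hq.1.2]
      exact Finset.sum_le_sum_of_subset_of_nonneg (Finset.filter_subset _ _) fun f _ _ => hq.1.1 f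
    exact (mul_le_of_le_one_right hPa hq1).trans (le_add_of_nonneg_right (by positivity))
  · rw [zero_add]
    exact mul_le_mul_of_nonneg_left (hq.2 a x.1 ha) hPa

lemma sum_mul_condProb_hashDist_le [DecidableEq A] (hP : ∀ x, 0 ≤ P x) {M : ℕ}
    {q : (A → Fin M) → ℝ} (hq : IsUniversalTwo q) (x : A × E) :
    ∑ f, q f * condProb (hashDist P f) (f x.1, x.2) ≤ condProb P x + 1 / M := by
  simp_rw [condProb, margE_hashDist, ← mul_div_assoc, ← Finset.sum_div]
  rcases (margE_nonneg hP x.2).eq_or_lt with h | h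
  · rw [← h, div_zero, div_zero, zero_add]
    positivity
  · rw [div_add' _ _ _ h.ne', mul_comm (1 / (M : ℝ))]
    gcongr
    exact sum_mul_hashDist_le hP hq x

lemma sum_mul_log_add_log_condProb_hashDist_le [DecidableEq A] (hP : ∀ x, 0 ≤ P x)
    {M : ℕ} {q : (A → Fin M) → ℝ} (hq : IsUniversalTwo q) {x : A × E} (hx : 0 < P x) :
    ∑ f, q f * (Real.log M + Real.log (condProb (hashDist P f) (f x.1, x.2))) ≤
      Real.log (1 + M * condProb P x) := by
  obtain ⟨f₀, hf₀⟩ := exists_pos_of_mem_stdSimplex hq.1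
  have hM : (0 : ℝ) < M := by exact_mod_cast (f₀ x.1).pos
  have hc (f : A → Fin M) : 0 < condProb (hashDist P f) (f x.1, x.2) :=
    condProb_pos (fun _ => Finset.sum_nonneg fun _ _ => hP _) (hx.trans_le (le_hashDist hP f x))
  have hJensen := strictConcaveOn_log_Ioi.concaveOn.le_map_sum (t := Finset.univ) (w := q)
    (p := fun f => M * condProb (hashDist P f) (f x.1, x.2)) (fun f _ => hq.1.1 f) hq.1.2
    (fun f _ => mul_pos hM (hc f))
  simp only [smul_eq_mul, Real.log_mul hM.ne' (hc _).ne'] at hJensen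
  refine hJensen.trans (Real.log_le_log ?_ ?_)
  · exact Finset.sum_pos' (fun f _ => mul_nonneg (hq.1.1 f) (mul_pos hM (hc f)).le)
      ⟨f₀, Finset.mem_univ f₀, mul_pos hf₀ (mul_pos hM (hc f₀))⟩
  · simp_rw [mul_left_comm _ (M : ℝ), ← Finset.mul_sum]
    refine (mul_le_mul_of_nonneg_left (sum_mul_condProb_hashDist_le hP hq x) hM.le).trans_eq ?_
    rw [mul_add, mul_one_div_cancel hM.ne', add_comm]

lemma entropy_le_log_card {ι : Type*} [Fintype ι] {p : ι → ℝ} (hp : p ∈ stdSimplex ℝ ι) :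
    entropy p ≤ Real.log (Fintype.card ι) := by
  obtain ⟨x, -⟩ := exists_pos_of_mem_stdSimplex hp
  have hcard : (0 : ℝ) < Fintype.card ι := by exact_mod_cast Fintype.card_pos_iff.2 ⟨x⟩
  have hJensen := Real.concaveOn_negMulLog.le_map_sum (t := Finset.univ)
    (w := fun _ : ι => (Fintype.card ι : ℝ)⁻¹) (p := p) (fun _ _ => by positivity)
    (by simp [hcard.ne']) (fun i _ => hp.1 i)
  simp only [smul_eq_mul, ← Finset.mul_sum, hp.2, mul_one, Real.negMulLog, Real.log_inv,
    neg_mul_neg] at hJensen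
  simpa [entropy, Real.negMulLog] using le_of_mul_le_mul_left hJensen (inv_pos.2 hcard)

variable [Fintype E]

lemma sum_hashDist_mul {M : ℕ} (P : A × E → ℝ) (f : A → Fin M) (g : Fin M × E → ℝ) :
    ∑ y, hashDist P f y * g y = ∑ x : A × E, P x * g (f x.1, x.2) := by
  simp_rw [hashDist, Fintype.sum_prod_type_right, Finset.sum_mul]
  refine Finset.sum_congr rfl fun e _ => ?_
  rw [← Finset.sum_fiberwise Finset.univ f]
  exact Finset.sum_congr rfl fun b _ => Finset.sum_congr rfl fun a ha => by
    rw [(Finset.mem_filter.1 ha).2]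

lemma hashDist_mem_stdSimplex (hP : P ∈ stdSimplex ℝ (A × E)) {M : ℕ} (f : A → Fin M) :
    hashDist P f ∈ stdSimplex ℝ (Fin M × E) :=
  ⟨fun _ => Finset.sum_nonneg fun _ _ => hP.1 _, by
    simpa [hP.2] using sum_hashDist_mul P f fun _ => 1⟩

lemma margA_mem_stdSimplex (hP : P ∈ stdSimplex ℝ (A × E)) : margA P ∈ stdSimplex ℝ A :=
  ⟨fun _ => Finset.sum_nonneg fun _ _ => hP.1 _, by
    simpa [margA, Fintype.sum_prod_type] using hP.2⟩

lemma margE_mem_stdSimplex (hP : P ∈ stdSimplex ℝ (A × E)) : margE P ∈ stdSimplex ℝ E :=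
  ⟨margE_nonneg hP.1, by simpa [margE, Fintype.sum_prod_type_right] using hP.2⟩

lemma mutualInfo_hashDist_le (hP : P ∈ stdSimplex ℝ (A × E)) {M : ℕ} (f : A → Fin M) :
    mutualInfo (hashDist P f) ≤ Real.log M - condEntropy (hashDist P f) := by
  have := entropy_le_log_card (margA_mem_stdSimplex (hashDist_mem_stdSimplex hP f))
  rw [Fintype.card_fin] at this
  exact sub_le_sub_right this _

lemma condEntropy_le_entropy_margA (hP : P ∈ stdSimplex ℝ (A × E)) :
    condEntropy P ≤ entropy (margA P) := by
  rw [condEntropy, entropy, Fintype.sum_prod_type, ← Finset.sum_neg_distrib]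
  refine Finset.sum_le_sum fun a _ => ?_
  calc -∑ e, P (a, e) * Real.log (condProb P (a, e))
      = ∑ e, margE P e * Real.negMulLog (condProb P (a, e)) := by
        rw [← Finset.sum_neg_distrib]
        refine Finset.sum_congr rfl fun e _ => ?_
        rw [Real.negMulLog, ← mul_assoc, mul_neg, margE_mul_condProb hP.1 (a, e), neg_mul]
    _ ≤ Real.negMulLog (∑ e, margE P e * condProb P (a, e)) := by
        have hE := margE_mem_stdSimplex hP
        exact Real.concaveOn_negMulLog.le_map_sum (fun e _ => hE.1 e) hE.2
          fun e _ => condProb_nonneg hP.1 (a, e)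
    _ = Real.negMulLog (margA P a) :=
        congrArg _ (Finset.sum_congr rfl fun e _ => margE_mul_condProb hP.1 (a, e))

lemma log_sub_condEntropy_hashDist (hP : P ∈ stdSimplex ℝ (A × E)) {M : ℕ} (f : A → Fin M) :
    Real.log M - condEntropy (hashDist P f) =
      ∑ x, P x * (Real.log M + Real.log (condProb (hashDist P f) (f x.1, x.2))) := by
  rw [condEntropy, sum_hashDist_mul P f fun y => Real.log (condProb (hashDist P f) y)]
  simp_rw [mul_add, Finset.sum_add_distrib, ← Finset.sum_mul, hP.2]
  ring

lemma sum_mul_log_sub_condEntropy_le [DecidableEq A] (hP : P ∈ stdSimplex ℝ (A × E)) {M : ℕ}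
    {q : (A → Fin M) → ℝ} (hq : IsUniversalTwo q) :
    ∑ f, q f * (Real.log M - condEntropy (hashDist P f)) ≤
      ∑ x, P x * Real.log (1 + M * condProb P x) := by
  simp_rw [log_sub_condEntropy_hashDist hP, Finset.mul_sum]
  rw [Finset.sum_comm]
  refine Finset.sum_le_sum fun x _ => ?_
  simp_rw [mul_left_comm _ (P x), ← Finset.mul_sum]
  rcases (hP.1 x).eq_or_lt with hx | hx
  · simp [← hx]
  · exact mul_le_mul_of_nonneg_left (sum_mul_log_add_log_condProb_hashDist_le hP.1 hq hx) hx.le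

lemma expectedLeakage_le_sum_log [DecidableEq A] (hP : P ∈ stdSimplex ℝ (A × E)) {M : ℕ}
    {q : (A → Fin M) → ℝ} (hq : IsUniversalTwo q) :
    expectedLeakage P q ≤ ∑ x, P x * Real.log (1 + M * condProb P x) :=
  (Finset.sum_le_sum fun f _ => mul_le_mul_of_nonneg_left (mutualInfo_hashDist_le hP f)
    (hq.1.1 f)).trans (sum_mul_log_sub_condEntropy_le hP hq)

end Hashing

section LeakageBound

variable {A E : Type*} [Fintype A] {P : A × E → ℝ}

lemma exists_isLeast_neg_log_condProb {ε : ℝ} (hε : ε < 1) {Ω : Finset (A × E)}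
    (hΩ : 1 - ε ≤ ∑ x ∈ Ω, P x) :
    ∃ h, IsLeast ((fun x => -Real.log (condProb P x)) '' {x | x ∈ Ω ∧ 0 < P x}) h := by
  set S := (fun x => -Real.log (condProb P x)) '' {x | x ∈ Ω ∧ 0 < P x}
  have hfin : S.Finite := (Ω.finite_toSet.subset fun _ hx => hx.1).image _
  obtain ⟨x, hx, hpos⟩ := Finset.exists_lt_of_sum_lt (s := Ω) (f := fun _ => 0) (g := P)
    (by rw [Finset.sum_const_zero]; linarith)
  have hne : S.Nonempty := ⟨_, x, ⟨hx, hpos⟩, rfl⟩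
  exact ⟨sInf S, hne.csInf_mem hfin, fun h hh => csInf_le hfin.bddBelow hh⟩

variable [Fintype E]

lemma isGreatest_smoothMinEntropy (hP : P ∈ stdSimplex ℝ (A × E)) {ε : ℝ} (h0 : 0 ≤ ε)
    (h1 : ε < 1) :
    IsGreatest {h : ℝ | ∃ Ω : Finset (A × E), 1 - ε ≤ ∑ x ∈ Ω, P x ∧
      IsLeast ((fun x => -Real.log (condProb P x)) '' {x | x ∈ Ω ∧ 0 < P x}) h}
      (smoothMinEntropy P ε) := by
  have huniv : 1 - ε ≤ ∑ x, P x := by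
    rw [hP.2]
    linarith
  obtain ⟨h, hh⟩ := exists_isLeast_neg_log_condProb h1 huniv
  have hfin : {h : ℝ | ∃ Ω : Finset (A × E), 1 - ε ≤ ∑ x ∈ Ω, P x ∧
      IsLeast ((fun x => -Real.log (condProb P x)) '' {x | x ∈ Ω ∧ 0 < P x}) h}.Finite := by
    refine (Set.finite_range fun x => -Real.log (condProb P x)).subset ?_
    rintro _ ⟨Ω, -, ⟨x, -, rfl⟩, -⟩
    exact Set.mem_range_self x
  exact ⟨Set.Nonempty.csSup_mem ⟨h, Finset.univ, huniv, hh⟩ hfin,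
    fun k hk => le_csSup hfin.bddAbove hk⟩

lemma le_smoothMinEntropy_iff (hP : P ∈ stdSimplex ℝ (A × E)) {ε h : ℝ} (h0 : 0 ≤ ε)
    (h1 : ε < 1) :
    h ≤ smoothMinEntropy P ε ↔ ∑ x with Real.exp (-h) < condProb P x, P x ≤ ε := by
  classical
  have hgreatest := isGreatest_smoothMinEntropy hP h0 h1
  constructor
  · intro hle
    obtain ⟨Ω, hΩ, hleast⟩ := hgreatest.1
    refine le_trans ?_ ((sum_compl_le_iff hP).2 hΩ)
    rw [← Finset.sum_filter_ne_zero]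
    refine Finset.sum_le_sum_of_subset_of_nonneg (fun x hx => ?_) fun x _ _ => hP.1 x
    simp only [Finset.mem_filter, Finset.mem_univ, true_and] at hx
    have hpos : 0 < P x := (hP.1 x).lt_of_ne' hx.2
    refine Finset.mem_compl.2 fun hxΩ => hx.1.not_ge ?_
    rw [← Real.log_le_iff_le_exp (condProb_pos hP.1 hpos), le_neg]
    exact hle.trans (hleast.2 ⟨x, ⟨hxΩ, hpos⟩, rfl⟩)
  · intro hmass
    set Ω : Finset (A × E) := {x | ¬ Real.exp (-h) < condProb P x}
    have hΩ : 1 - ε ≤ ∑ x ∈ Ω, P x := by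
      rw [← sum_compl_le_iff hP, Finset.compl_filter]
      simpa only [not_not] using hmass
    obtain ⟨_, hleast⟩ := exists_isLeast_neg_log_condProb h1 hΩ
    obtain ⟨x, ⟨hx, hpos⟩, rfl⟩ := hleast.1
    refine le_trans ?_ (hgreatest.2 ⟨Ω, hΩ, hleast⟩)
    change h ≤ -Real.log (condProb P x)
    rw [le_neg, Real.log_le_iff_le_exp (condProb_pos hP.1 hpos)]
    exact not_lt.1 (Finset.mem_filter.1 hx).2

lemma sum_mul_log_one_add_le (hP : P ∈ stdSimplex ℝ (A × E)) {ε M : ℝ} (h0 : 0 ≤ ε) (h1 : ε < 1)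
    (hM : 0 ≤ M) :
    ∑ x, P x * Real.log (1 + M * condProb P x) ≤
      M * Real.exp (-smoothMinEntropy P ε) + ε * Real.log (1 + M) := by
  set c := Real.exp (-smoothMinEntropy P ε)
  have htail : ∑ x with c < condProb P x, P x ≤ ε := (le_smoothMinEntropy_iff hP h0 h1).1 le_rfl
  have hlogM : 0 ≤ Real.log (1 + M) := Real.log_nonneg (by linarith)
  calc ∑ x, P x * Real.log (1 + M * condProb P x)
      ≤ ∑ x, (P x * (M * c) + (if c < condProb P x then P x else 0) * Real.log (1 + M)) := by
        refine Finset.sum_le_sum fun x _ => ?_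
        have hPx := hP.1 x
        have hMc : 0 ≤ M * condProb P x := mul_nonneg hM (condProb_nonneg hP.1 x)
        split_ifs with hx
        · have : Real.log (1 + M * condProb P x) ≤ Real.log (1 + M) := by
            gcongr
            exact mul_le_of_le_one_right hM (condProb_le_one hP.1 x)
          exact (mul_le_mul_of_nonneg_left this hPx).trans
            (le_add_of_nonneg_left (mul_nonneg hPx (by positivity)))
        · rw [zero_mul, add_zero]
          refine mul_le_mul_of_nonneg_left ?_ hPx
          have := mul_le_mul_of_nonneg_left (not_lt.1 hx) hM
          linarith [Real.log_le_sub_one_of_pos (x := 1 + M * condProb P x) (by linarith)]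
    _ = M * c + (∑ x with c < condProb P x, P x) * Real.log (1 + M) := by
        rw [Finset.sum_add_distrib, ← Finset.sum_mul, ← Finset.sum_mul, hP.2, one_mul,
          Finset.sum_filter]
    _ ≤ M * c + ε * Real.log (1 + M) := by gcongr

lemma mul_log_two_add_le_two_mul_eta {ε m : ℝ} (h0 : 0 < ε) (h1 : ε < 1 / 4) (hm : 0 ≤ m) :
    ε * (Real.log 2 + m) ≤ 2 * eta (2 * ε) m := by
  have hlog2 := Real.log_pos one_lt_two
  have hlog : Real.log (2 * ε) ≤ -Real.log 2 := by
    rw [← Real.log_inv]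
    exact Real.log_le_log (by linarith) (by linarith)
  unfold eta
  nlinarith [mul_nonneg h0.le hm, mul_nonneg h0.le hlog2.le, mul_le_mul_of_nonneg_left hlog h0.le]

lemma two_mul_eta_two_mul_le {ε : ℝ} (hε : 0 < ε) (a : ℝ) :
    2 * eta (2 * ε) a ≤ 4 * ε * (a - Real.log ε) := by
  rw [eta, Real.log_mul two_ne_zero hε.ne']
  nlinarith [mul_pos hε (Real.log_pos one_lt_two)]

lemma expectedLeakage_le_smoothLeakageBound [DecidableEq A] (hP : P ∈ stdSimplex ℝ (A × E))
    {M : ℕ} {q : (A → Fin M) → ℝ} (hq : IsUniversalTwo q) :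
    expectedLeakage P q ≤ smoothLeakageBound P M := by
  obtain ⟨f₀, -⟩ := exists_pos_of_mem_stdSimplex hq.1
  obtain ⟨x₀, -⟩ := exists_pos_of_mem_stdSimplex hP
  have hM : (1 : ℝ) ≤ M := by exact_mod_cast (f₀ x₀.1).pos
  have hA : (1 : ℝ) ≤ Fintype.card A := by exact_mod_cast Fintype.card_pos_iff.2 ⟨x₀.1⟩
  have hAM : (M : ℝ) ≤ Fintype.card A * M := le_mul_of_one_le_left (by linarith) hA
  have hlog : Real.log (1 + M) ≤ Real.log 2 + Real.log (Fintype.card A * M) := by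
    rw [← Real.log_mul two_ne_zero (by positivity)]
    exact Real.log_le_log (by linarith) (by linarith)
  refine le_csInf ((Set.nonempty_Ioo.2 (by norm_num)).image _) ?_
  rintro _ ⟨ε, ⟨h0, h1⟩, rfl⟩
  calc expectedLeakage P q
      ≤ ∑ x, P x * Real.log (1 + M * condProb P x) := expectedLeakage_le_sum_log hP hq
    _ ≤ M * Real.exp (-smoothMinEntropy P ε) + ε * Real.log (1 + M) :=
        sum_mul_log_one_add_le hP h0.le (by linarith) (by linarith)
    _ ≤ M * Real.exp (-smoothMinEntropy P ε) +
          ε * (Real.log 2 + Real.log (Fintype.card A * M)) := by gcongr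
    _ ≤ M * Real.exp (-smoothMinEntropy P ε) +
          2 * eta (2 * ε) (Real.log (Fintype.card A * M)) := by
        rw [add_le_add_iff_left]
        exact mul_log_two_add_le_two_mul_eta h0 h1 (Real.log_nonneg (hM.trans hAM))

lemma log_two_mul_le_two_mul_eta (A : Type*) [Fintype A] {M ε : ℝ} (hM : 1 ≤ M) (h0 : 0 < ε)
    (h1 : ε < 1 / 4) :
    Real.log 2 * ε ≤ 2 * eta (2 * ε) (Real.log (Fintype.card A * M)) := by
  have hlog : 0 ≤ Real.log (Fintype.card A * M) := by
    rcases isEmpty_or_nonempty A with hA | hA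
    · simp
    · have : (1 : ℝ) ≤ Fintype.card A := by exact_mod_cast Fintype.card_pos
      exact Real.log_nonneg (one_le_mul_of_one_le_of_one_le this hM)
  refine le_trans ?_ (mul_log_two_add_le_two_mul_eta h0 h1 hlog)
  rw [mul_comm]
  gcongr
  linarith

lemma smoothLeakageBound_le (P : A × E → ℝ) {M ε : ℝ} (hM : 1 ≤ M) (h0 : 0 < ε)
    (h1 : ε < 1 / 4) :
    smoothLeakageBound P M ≤ M * Real.exp (-smoothMinEntropy P ε) +
      2 * eta (2 * ε) (Real.log (Fintype.card A * M)) := by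
  refine csInf_le ⟨0, ?_⟩ ⟨ε, ⟨h0, h1⟩, rfl⟩
  rintro _ ⟨u, ⟨hu0, hu1⟩, rfl⟩
  exact add_nonneg (by positivity)
    ((by positivity : 0 ≤ Real.log 2 * u).trans (log_two_mul_le_two_mul_eta A hM hu0 hu1))

lemma min_le_smoothLeakageBound (hP : P ∈ stdSimplex ℝ (A × E)) {M : ℝ} (hM : 1 ≤ M) (h : ℝ) :
    min (M * Real.exp (-h)) (Real.log 2 * ∑ x with Real.exp (-h) ≤ condProb P x, P x) ≤
      smoothLeakageBound P M := by
  refine le_csInf ((Set.nonempty_Ioo.2 (by norm_num)).image _) ?_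
  rintro _ ⟨ε, ⟨h0, h1⟩, rfl⟩
  have heta := log_two_mul_le_two_mul_eta A hM h0 h1
  rcases le_or_gt (smoothMinEntropy P ε) h with hle | hlt
  · refine (min_le_left _ _).trans
      (le_add_of_le_of_nonneg ?_ (le_trans (by positivity) heta))
    gcongr
  · refine (min_le_right _ _).trans (le_add_of_nonneg_of_le (by positivity) (le_trans ?_ heta))
    gcongr
    refine le_trans (Finset.sum_le_sum_of_subset_of_nonneg ?_ fun x _ _ => hP.1 x)
      ((le_smoothMinEntropy_iff hP h0.le (by linarith)).1 le_rfl)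
    refine Finset.monotone_filter_right _ fun x _ hx => ?_
    exact (Real.exp_lt_exp.2 (neg_lt_neg hlt)).trans_le hx

end LeakageBound

section Iid

variable {A E : Type*} [Fintype A] {P : A × E → ℝ}

/-- Logarithm of the conditional probability, the statistic whose large deviations under `P^n`
govern the smooth min-entropy; it takes the junk value `0` at points of probability zero. -/
noncomputable def logCondProb (P : A × E → ℝ) (x : A × E) : ℝ := Real.log (condProb P x)

lemma logCondProb_ne (hP : ∀ x, 0 ≤ P x) {x y : A × E} (hx : 0 < P x) (hy : 0 < P y)
    (hxy : condProb P x ≠ condProb P y) : logCondProb P x ≠ logCondProb P y := fun h =>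
  hxy (Real.log_injOn_pos (condProb_pos hP hx) (condProb_pos hP hy) h)

lemma margE_iidDist (P : A × E → ℝ) (n : ℕ) (e : Fin n → E) :
    margE (iidDist P n) e = ∏ i, margE P (e i) := by
  classical
  simp only [margE, iidDist]
  rw [Finset.prod_univ_sum, Fintype.piFinset_univ]

lemma condProb_iidDist (P : A × E → ℝ) (n : ℕ) (x : (Fin n → A) × (Fin n → E)) :
    condProb (iidDist P n) x = ∏ i, condProb P (x.1 i, x.2 i) := by
  rw [condProb, margE_iidDist, iidDist, ← Finset.prod_div_distrib]
  rfl

lemma condProb_iidDist_eq_exp (hP : ∀ x, 0 ≤ P x) {n : ℕ} {y : Fin n → A × E}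
    (hy : ∏ i, P (y i) ≠ 0) :
    condProb (iidDist P n) (fun i => (y i).1, fun i => (y i).2) =
      Real.exp (∑ i, logCondProb P (y i)) := by
  rw [condProb_iidDist, Real.exp_sum]
  refine Finset.prod_congr rfl fun i _ => (Real.exp_log (condProb_pos hP ?_)).symm
  exact (hP _).lt_of_ne' (Finset.prod_ne_zero_iff.1 hy i (Finset.mem_univ i))

variable [Fintype E]

lemma sum_prod_arrow {β : Type*} [AddCommMonoid β] (n : ℕ)
    (g : (Fin n → A) × (Fin n → E) → β) :
    ∑ x, g x = ∑ y : Fin n → A × E, g (fun i => (y i).1, fun i => (y i).2) :=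
  ((Equiv.arrowProdEquivProdArrow (Fin n) (fun _ => A) fun _ => E).sum_comp g).symm

lemma iidDist_mem_stdSimplex (hP : P ∈ stdSimplex ℝ (A × E)) (n : ℕ) :
    iidDist P n ∈ stdSimplex ℝ ((Fin n → A) × (Fin n → E)) :=
  ⟨fun _ => Finset.prod_nonneg fun _ _ => hP.1 _, by
    rw [sum_prod_arrow]
    exact (prod_mem_stdSimplex hP n).2⟩

lemma sum_iidDist_condProb_ge (hP : ∀ x, 0 ≤ P x) (n : ℕ) (r : ℝ) :
    ∑ x with Real.exp (-(n * r)) ≤ condProb (iidDist P n) x, iidDist P n x =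
      upperTail P (logCondProb P) n (-r) := by
  rw [Finset.sum_filter, sum_prod_arrow, upperTail, Finset.sum_filter]
  refine Finset.sum_congr rfl fun y _ => ?_
  simp only [iidDist, Prod.mk.eta]
  by_cases hy : ∏ i, P (y i) = 0
  · simp [hy]
  · simp only [condProb_iidDist_eq_exp hP hy, Real.exp_le_exp, mul_neg]

lemma sum_iidDist_mul_condProb_rpow (hP : ∀ x, 0 ≤ P x) (n : ℕ) (s : ℝ) :
    ∑ x, iidDist P n x * condProb (iidDist P n) x ^ s = expMoment P (logCondProb P) s ^ n := by
  rw [sum_prod_arrow, expMoment, Fintype.sum_pow]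
  refine Finset.sum_congr rfl fun y _ => ?_
  rw [Finset.prod_mul_distrib]
  by_cases hy : ∏ i, P (y i) = 0
  · simp [hy, iidDist]
  · rw [condProb_iidDist_eq_exp hP hy, ← Real.exp_mul, ← Real.exp_sum, ← Finset.mul_sum,
      mul_comm s]
    rfl

lemma renyiTilde_eq_neg_log_expMoment (hP : ∀ x, 0 ≤ P x) {s : ℝ} (hs : 0 ≤ s) :
    renyiTilde P s = -Real.log (expMoment P (logCondProb P) s) := by
  rw [renyiTilde, expMoment]
  congr 2
  refine Finset.sum_congr rfl fun x _ => ?_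
  rcases (hP x).eq_or_lt with hx | hx
  · simp [condProb, ← hx, Real.zero_rpow (by linarith : 1 + s ≠ 0)]
  · have hc := condProb_pos hP hx
    rw [Real.rpow_add hc, Real.rpow_one, Real.rpow_def_of_pos hc, ← mul_assoc,
      margE_mul_condProb hP, mul_comm s, logCondProb]

lemma mul_le_smoothMinEntropy_iidDist (hP : P ∈ stdSimplex ℝ (A × E)) {s r c : ℝ} (hs : 0 ≤ s)
    (hc : c ≤ renyiTilde P s - s * r) {n : ℕ} (hn : Real.exp (-(n * c)) < 1) :
    n * r ≤ smoothMinEntropy (iidDist P n) (Real.exp (-(n * c))) := by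
  have hPn := iidDist_mem_stdSimplex hP n
  rw [le_smoothMinEntropy_iff hPn (Real.exp_pos _).le hn]
  calc ∑ x with Real.exp (-(n * r)) < condProb (iidDist P n) x, iidDist P n x
      ≤ ∑ x with Real.exp (-(n * r)) ≤ condProb (iidDist P n) x, iidDist P n x :=
        Finset.sum_le_sum_of_subset_of_nonneg
          (Finset.monotone_filter_right _ fun _ _ => le_of_lt) fun x _ _ => hPn.1 x
    _ = upperTail P (logCondProb P) n (-r) := sum_iidDist_condProb_ge hP.1 n r
    _ ≤ Real.exp (-(n * (s * -r - Real.log (expMoment P (logCondProb P) s)))) :=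
        upperTail_le_exp hP _ n _ hs
    _ ≤ Real.exp (-(n * c)) := by
        rw [renyiTilde_eq_neg_log_expMoment hP.1 hs] at hc
        gcongr
        linarith

lemma log_card_mul_exp [Nonempty A] (n : ℕ) (R : ℝ) :
    Real.log (Fintype.card (Fin n → A) * Real.exp (n * R)) =
      n * (Real.log (Fintype.card A) + R) := by
  rw [Fintype.card_fun, Fintype.card_fin, Nat.cast_pow, Real.log_mul
    (pow_ne_zero n (Nat.cast_ne_zero.2 Fintype.card_ne_zero)) (Real.exp_pos _).ne', Real.log_exp,
    Real.log_pow, mul_add]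

lemma smoothLeakageBound_iidDist_le (hP : P ∈ stdSimplex ℝ (A × E)) {R s w c : ℝ} (hR : 0 ≤ R)
    (hs : 0 ≤ s) (hc : c ≤ renyiTilde P s - s * (R + w)) {n : ℕ}
    (hn : Real.exp (-(n * c)) < 1 / 4) :
    smoothLeakageBound (iidDist P n) (Real.exp (n * R)) ≤
      Real.exp (-(n * w)) +
        4 * (Real.log (Fintype.card A) + R + c) * n * Real.exp (-(n * c)) := by
  obtain ⟨x, -⟩ := exists_pos_of_mem_stdSimplex hP
  have : Nonempty A := ⟨x.1⟩
  refine (smoothLeakageBound_le _ (Real.one_le_exp (by positivity)) (Real.exp_pos _) hn).trans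
    (add_le_add ?_ ?_)
  · rw [← Real.exp_add, Real.exp_le_exp]
    linarith [mul_le_smoothMinEntropy_iidDist hP hs hc (hn.trans (by norm_num))]
  · refine (two_mul_eta_two_mul_le (Real.exp_pos _) _).trans_eq ?_
    rw [log_card_mul_exp, Real.log_exp]
    ring

lemma eventually_smoothLeakageBound_le_exp (hP : P ∈ stdSimplex ℝ (A × E)) {R s w c δ : ℝ}
    (hR : 0 ≤ R) (hs : 0 ≤ s) (hc : c ≤ renyiTilde P s - s * (R + w)) (hc0 : 0 < c) (hwc : w ≤ c)
    (hδ : 0 < δ) :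
    ∀ᶠ n : ℕ in atTop, smoothLeakageBound (iidDist P n) (Real.exp (n * R)) ≤
      Real.exp (-(n * (w - δ))) := by
  obtain ⟨x, -⟩ := exists_pos_of_mem_stdSimplex hP
  have hA : (1 : ℝ) ≤ Fintype.card A := by exact_mod_cast Fintype.card_pos_iff.2 ⟨x.1⟩
  have := Real.log_nonneg hA
  set C := 4 * (Real.log (Fintype.card A) + R + c)
  filter_upwards [(tendsto_exp_neg_natCast_mul hc0).eventually_lt_const
    (by norm_num : (0 : ℝ) < 1 / 4), eventually_one_add_mul_le_exp C hδ] with n hn hCn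
  calc smoothLeakageBound (iidDist P n) (Real.exp (n * R))
      ≤ Real.exp (-(n * w)) + C * n * Real.exp (-(n * c)) :=
        smoothLeakageBound_iidDist_le hP hR hs hc hn
    _ ≤ Real.exp (-(n * w)) + C * n * Real.exp (-(n * w)) := by gcongr
    _ = (1 + C * n) * Real.exp (-(n * w)) := by ring
    _ ≤ Real.exp (n * δ) * Real.exp (-(n * w)) := by gcongr
    _ = Real.exp (-(n * (w - δ))) := by
        rw [← Real.exp_add]
        ring_nf

lemma eventually_exp_le_smoothLeakageBound (hP : P ∈ stdSimplex ℝ (A × E)) {R W δ : ℝ}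
    (hR : 0 ≤ R) (hW : ∀ s, 0 ≤ s → renyiTilde P s - s * R ≤ W * (1 + s)) (hδ : 0 < δ) :
    ∀ᶠ n : ℕ in atTop, Real.exp (-(n * (W + δ))) ≤
      smoothLeakageBound (iidDist P n) (Real.exp (n * R)) := by
  have hlog2 := Real.log_pos one_lt_two
  have htail := eventually_exp_le_upperTail hP (L := logCondProb P) (t := -(R + W + δ))
    (u := -(R + W)) (W := W) (by linarith) fun s hs => by
      have := hW s hs
      rw [renyiTilde_eq_neg_log_expMoment hP.1 hs] at this
      linarith
  have hexp : ∀ᶠ n : ℕ in atTop, 2 / Real.log 2 ≤ Real.exp (n * δ) :=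
    (Real.tendsto_exp_atTop.comp
      (tendsto_natCast_atTop_atTop.atTop_mul_const hδ)).eventually_ge_atTop _
  filter_upwards [htail, hexp] with n hn hδn
  refine le_trans (le_min ?_ ?_) (min_le_smoothLeakageBound (iidDist_mem_stdSimplex hP n)
    (Real.one_le_exp (by positivity)) (n * (R + W + δ)))
  · rw [← Real.exp_add, Real.exp_le_exp]
    linarith
  · rw [div_le_iff₀ hlog2] at hδn
    rw [sum_iidDist_condProb_ge hP.1]
    calc Real.exp (-(n * (W + δ)))
        ≤ Real.exp (n * δ) * Real.log 2 / 2 * Real.exp (-(n * (W + δ))) :=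
          le_mul_of_one_le_left (Real.exp_pos _).le (by linarith)
      _ = Real.log 2 * (1 / 2 * (Real.exp (n * δ) * Real.exp (-(n * (W + δ))))) := by ring
      _ = Real.log 2 * (1 / 2 * Real.exp (-(n * W))) := by
          rw [← Real.exp_add]
          ring_nf
      _ ≤ Real.log 2 * upperTail P (logCondProb P) n (-(R + W + δ)) := by gcongr

end Iid

section Exponents

variable {A E : Type*} [Fintype A] [Fintype E] {P : A × E → ℝ}

/-- The exponent `sup_{s ≥ 0} s / (1 + s) (H_{1+s}(A|E) - R)` obtained from the smooth
min-entropy, denoted `W` in the theorem. -/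
noncomputable def minEntropyExponent (P : A × E → ℝ) (R : ℝ) : ℝ :=
  sSup ((fun s : ℝ => s / (1 + s) * (condRenyi P s - R)) '' Set.Ici 0)

/-- The exponent `max_{0 ≤ s ≤ 1} s (H_{1+s}(A|E) - R)` obtained from the Rényi entropies, denoted
`V` in the theorem. -/
noncomputable def renyiExponent (P : A × E → ℝ) (R : ℝ) : ℝ :=
  sSup ((fun s : ℝ => s * (condRenyi P s - R)) '' Set.Icc 0 1)

lemma renyiTilde_zero (hP : P ∈ stdSimplex ℝ (A × E)) : renyiTilde P 0 = 0 := by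
  rw [renyiTilde_eq_neg_log_expMoment hP.1 le_rfl, expMoment_zero _ hP, Real.log_one, neg_zero]

lemma mul_condRenyi_sub (hP : P ∈ stdSimplex ℝ (A × E)) (R s : ℝ) :
    s * (condRenyi P s - R) = renyiTilde P s - s * R := by
  by_cases hs : s = 0
  · simp [hs, renyiTilde_zero hP]
  · rw [condRenyi, if_neg hs]
    field_simp

lemma div_mul_condRenyi_sub (hP : P ∈ stdSimplex ℝ (A × E)) (R s : ℝ) :
    s / (1 + s) * (condRenyi P s - R) = (renyiTilde P s - s * R) / (1 + s) := by
  rw [div_mul_eq_mul_div, mul_condRenyi_sub hP]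

lemma continuousOn_renyiTilde (hP : P ∈ stdSimplex ℝ (A × E)) :
    ContinuousOn (renyiTilde P) (Set.Ici 0) :=
  (continuous_log_expMoment (logCondProb P) hP).neg.continuousOn.congr
    fun _ hs => renyiTilde_eq_neg_log_expMoment hP.1 hs

lemma exists_renyiTilde_sub_pos (hP : P ∈ stdSimplex ℝ (A × E)) {r : ℝ}
    (hr : r < condEntropy P) : ∃ s, 0 < s ∧ s ≤ 1 ∧ 0 < renyiTilde P s - s * r := by
  obtain ⟨s, h0, h1, hlt⟩ := exists_log_expMoment_lt_mul hP (L := logCondProb P) (t := -r)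
    (lt_neg.1 hr)
  refine ⟨s, h0, h1, ?_⟩
  rw [renyiTilde_eq_neg_log_expMoment hP.1 h0.le]
  linarith

lemma mul_renyiTilde_le (hP : P ∈ stdSimplex ℝ (A × E)) {θ s : ℝ} (h0 : 0 ≤ θ) (h1 : θ ≤ 1)
    (hs : 0 ≤ s) : θ * renyiTilde P s ≤ renyiTilde P (θ * s) := by
  rw [renyiTilde_eq_neg_log_expMoment hP.1 hs,
    renyiTilde_eq_neg_log_expMoment hP.1 (mul_nonneg h0 hs), mul_neg]
  exact neg_le_neg (log_expMoment_mul_le hP _ s h0 h1)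

lemma mul_renyiTilde_lt (hP : P ∈ stdSimplex ℝ (A × E)) {θ s : ℝ} (h0 : 0 < θ) (h1 : θ < 1)
    (hs : 0 < s) {x y : A × E} (hx : 0 < P x) (hy : 0 < P y) (hxy : condProb P x ≠ condProb P y) :
    θ * renyiTilde P s < renyiTilde P (θ * s) := by
  rw [renyiTilde_eq_neg_log_expMoment hP.1 hs.le,
    renyiTilde_eq_neg_log_expMoment hP.1 (mul_nonneg h0.le hs.le), mul_neg]
  exact neg_lt_neg
    (log_expMoment_mul_lt hP hs.ne' h0 h1 hx hy (logCondProb_ne hP.1 hx hy hxy))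

lemma isGreatest_renyiExponent (hP : P ∈ stdSimplex ℝ (A × E)) (R : ℝ) :
    IsGreatest ((fun s : ℝ => s * (condRenyi P s - R)) '' Set.Icc 0 1) (renyiExponent P R) := by
  have hcont : ContinuousOn (fun s : ℝ => s * (condRenyi P s - R)) (Set.Icc 0 1) := by
    simp only [mul_condRenyi_sub hP]
    exact ((continuousOn_renyiTilde hP).mono Set.Icc_subset_Ici_self).sub (by fun_prop)
  obtain ⟨V, hV⟩ := (isCompact_Icc.image_of_continuousOn hcont).exists_isGreatest
    (Set.nonempty_Icc.2 zero_le_one |>.image _)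
  rwa [renyiExponent, hV.csSup_eq]

lemma renyiTilde_sub_le_renyiExponent (hP : P ∈ stdSimplex ℝ (A × E)) (R : ℝ) {s : ℝ}
    (h0 : 0 ≤ s) (h1 : s ≤ 1) : renyiTilde P s - s * R ≤ renyiExponent P R :=
  (isGreatest_renyiExponent hP R).2 ⟨s, ⟨h0, h1⟩, mul_condRenyi_sub hP R s⟩

lemma renyiExponent_pos (hP : P ∈ stdSimplex ℝ (A × E)) {R : ℝ} (hR : R < condEntropy P) :
    0 < renyiExponent P R := by
  obtain ⟨s, h0, h1, hpos⟩ := exists_renyiTilde_sub_pos hP hR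
  exact hpos.trans_le (renyiTilde_sub_le_renyiExponent hP R h0.le h1)

lemma renyiTilde_sub_div_le (hP : P ∈ stdSimplex ℝ (A × E)) (R : ℝ) {s : ℝ} (hs : 0 ≤ s) :
    (renyiTilde P s - s * R) / (1 + s) ≤ renyiExponent P R := by
  have hθ : 1 / (1 + s) ≤ 1 := div_le_one_of_le₀ (by linarith) (by linarith)
  have hθs : 1 / (1 + s) * s ≤ 1 := by
    rw [one_div_mul_eq_div]
    exact div_le_one_of_le₀ (by linarith) (by linarith)
  calc (renyiTilde P s - s * R) / (1 + s)
      = 1 / (1 + s) * renyiTilde P s - 1 / (1 + s) * s * R := by ring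
    _ ≤ renyiTilde P (1 / (1 + s) * s) - 1 / (1 + s) * s * R :=
        sub_le_sub_right (mul_renyiTilde_le hP (by positivity) hθ hs) _
    _ ≤ renyiExponent P R := renyiTilde_sub_le_renyiExponent hP R (by positivity) hθs

lemma renyiTilde_sub_div_lt (hP : P ∈ stdSimplex ℝ (A × E)) {R s : ℝ} (hR : R < condEntropy P)
    (hs : 0 ≤ s) {x y : A × E} (hx : 0 < P x) (hy : 0 < P y)
    (hxy : condProb P x ≠ condProb P y) :
    (renyiTilde P s - s * R) / (1 + s) < renyiExponent P R := by
  rcases hs.eq_or_lt with rfl | hs0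
  · simpa [renyiTilde_zero hP] using renyiExponent_pos hP hR
  have hθ : 1 / (1 + s) < 1 := (div_lt_one (by linarith)).2 (by linarith)
  have hθs : 1 / (1 + s) * s ≤ 1 := by
    rw [one_div_mul_eq_div]
    exact div_le_one_of_le₀ (by linarith) (by linarith)
  calc (renyiTilde P s - s * R) / (1 + s)
      = 1 / (1 + s) * renyiTilde P s - 1 / (1 + s) * s * R := by ring
    _ < renyiTilde P (1 / (1 + s) * s) - 1 / (1 + s) * s * R :=
        sub_lt_sub_right (mul_renyiTilde_lt hP (by positivity) hθ hs0 hx hy hxy) _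
    _ ≤ renyiExponent P R := renyiTilde_sub_le_renyiExponent hP R (by positivity) hθs

lemma isLUB_renyiTilde_sub_div (hP : P ∈ stdSimplex ℝ (A × E)) (R : ℝ) :
    IsLUB ((fun s : ℝ => (renyiTilde P s - s * R) / (1 + s)) '' Set.Ici 0)
      (minEntropyExponent P R) := by
  simp only [minEntropyExponent, div_mul_condRenyi_sub hP]
  refine isLUB_csSup (Set.nonempty_Ici.image _) ⟨renyiExponent P R, ?_⟩
  rintro _ ⟨s, hs, rfl⟩
  exact renyiTilde_sub_div_le hP R hs

lemma isLUB_minEntropyExponent (hP : P ∈ stdSimplex ℝ (A × E)) (R : ℝ) :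
    IsLUB ((fun s : ℝ => s / (1 + s) * (condRenyi P s - R)) '' Set.Ici 0)
      (minEntropyExponent P R) := by
  simpa only [div_mul_condRenyi_sub hP] using isLUB_renyiTilde_sub_div hP R

lemma minEntropyExponent_le_renyiExponent (hP : P ∈ stdSimplex ℝ (A × E)) (R : ℝ) :
    minEntropyExponent P R ≤ renyiExponent P R := by
  refine (isLUB_renyiTilde_sub_div hP R).2 ?_
  rintro _ ⟨s, hs, rfl⟩
  exact renyiTilde_sub_div_le hP R hs

lemma exists_eventually_renyiTilde_sub_div_le (hP : P ∈ stdSimplex ℝ (A × E)) (R : ℝ)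
    {x y : A × E} (hx : 0 < P x) (hy : 0 < P y) (hxy : condProb P x ≠ condProb P y) :
    ∃ m < renyiExponent P R, ∀ᶠ s in atTop, (renyiTilde P s - s * R) / (1 + s) ≤ m := by
  obtain ⟨b, c, hb, hlin⟩ := exists_log_expMoment_one_lt_slope hP hx hy
    (logCondProb_ne hP.1 hx hy hxy)
  have hbV : -b - R < renyiExponent P R := by
    have := renyiTilde_sub_le_renyiExponent hP R zero_le_one le_rfl
    rw [renyiTilde_eq_neg_log_expMoment hP.1 zero_le_one] at this
    linarith
  obtain ⟨m, hbm, hmV⟩ := exists_between hbV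
  have hlarge : ∀ᶠ s : ℝ in atTop, -c - m ≤ s * (m + b + R) :=
    (tendsto_id.atTop_mul_const (by linarith)).eventually_ge_atTop _
  refine ⟨m, hmV, ?_⟩
  filter_upwards [hlarge, eventually_ge_atTop 0] with s hs hs0
  rw [div_le_iff₀ (by linarith), renyiTilde_eq_neg_log_expMoment hP.1 hs0]
  linarith [hlin s]

/-- The pointwise strict inequality is uniform because the left-hand exponent stays below
`renyiExponent` as `s → ∞`. -/
lemma minEntropyExponent_lt_renyiExponent (hP : P ∈ stdSimplex ℝ (A × E)) {R : ℝ}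
    (hR : R < condEntropy P) {x y : A × E} (hx : 0 < P x) (hy : 0 < P y)
    (hxy : condProb P x ≠ condProb P y) : minEntropyExponent P R < renyiExponent P R := by
  have hcont : ContinuousOn (fun s => (renyiTilde P s - s * R) / (1 + s)) (Set.Ici 0) := by
    refine ((continuousOn_renyiTilde hP).sub (by fun_prop)).div (by fun_prop) fun s hs => ?_
    have hs0 : (0 : ℝ) ≤ s := hs
    positivity
  obtain ⟨m, hmV, hev⟩ := exists_eventually_renyiTilde_sub_div_le hP R hx hy hxy
  obtain ⟨w, hwV, hle⟩ := exists_lt_forall_le_of_eventually_le hcont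
    (fun s hs => renyiTilde_sub_div_lt hP hR hs hx hy hxy) hmV hev
  refine ((isLUB_renyiTilde_sub_div hP R).2 ?_).trans_lt hwV
  rintro _ ⟨s, hs, rfl⟩
  exact hle s hs

lemma coe_minEntropyExponent (hP : P ∈ stdSimplex ℝ (A × E)) (R : ℝ) :
    (minEntropyExponent P R : EReal) = ⨆ (R' : ℝ) (_ : R ≤ R'),
      min (⨆ (s : ℝ) (_ : 0 ≤ s), ((renyiTilde P s - s * R' : ℝ) : EReal)) ((R' - R : ℝ) : EReal) :=
  coe_eq_iSup_min_of_isLUB (renyiTilde_zero hP).ge (isLUB_renyiTilde_sub_div hP R)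

lemma exists_lt_renyiTilde_sub (hP : P ∈ stdSimplex ℝ (A × E)) {R w : ℝ}
    (hR : R ≤ condEntropy P) (hw : w < minEntropyExponent P R) :
    ∃ s, 0 ≤ s ∧ 0 < renyiTilde P s - s * (R + w) ∧ w ≤ renyiTilde P s - s * (R + w) := by
  rcases lt_or_ge w 0 with hw0 | hw0
  · obtain ⟨s, hs, -, hpos⟩ := exists_renyiTilde_sub_pos hP (r := R + w) (by linarith)
    exact ⟨s, hs.le, hpos, by linarith⟩
  · obtain ⟨_, ⟨s, hs, rfl⟩, hws, -⟩ := (isLUB_renyiTilde_sub_div hP R).exists_between hw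
    have hs0 : (0 : ℝ) ≤ s := hs
    change w < (renyiTilde P s - s * R) / (1 + s) at hws
    rw [lt_div_iff₀ (by linarith)] at hws
    exact ⟨s, hs0, by linarith, by linarith⟩

lemma tendsto_neg_log_smoothLeakageBound (hP : P ∈ stdSimplex ℝ (A × E)) {R : ℝ} (hR : 0 ≤ R)
    (hRH : R ≤ condEntropy P) :
    Tendsto (fun n : ℕ =>
        -(1 / (n : ℝ)) * Real.log (smoothLeakageBound (iidDist P n) (Real.exp (n * R))))
      atTop (𝓝 (minEntropyExponent P R)) := by
  refine tendsto_neg_div_mul_log (fun δ hδ => ?_) fun δ hδ => ?_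
  · refine eventually_exp_le_smoothLeakageBound hP hR (fun s hs => ?_) hδ
    exact (div_le_iff₀ (by linarith)).1 ((isLUB_renyiTilde_sub_div hP R).1 ⟨s, hs, rfl⟩)
  · obtain ⟨s, hs, hpos, hle⟩ := exists_lt_renyiTilde_sub hP hRH
      (sub_lt_self (minEntropyExponent P R) (half_pos hδ))
    filter_upwards [eventually_smoothLeakageBound_le_exp hP hR hs le_rfl hpos hle (half_pos hδ)]
      with n hn
    rwa [sub_sub, add_halves] at hn

end Exponents

section RandomHashing

variable {A E : Type*} [Fintype A] [Fintype E] {P : A × E → ℝ}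

lemma isUniversalTwo_uniform (A : Type*) [Fintype A] [DecidableEq A] {M : ℕ} (hM : 0 < M) :
    IsUniversalTwo fun _ : A → Fin M => (Fintype.card (A → Fin M) : ℝ)⁻¹ := by
  have : NeZero M := ⟨hM.ne'⟩
  have hM0 : (M : ℝ) ≠ 0 := by exact_mod_cast hM.ne'
  refine ⟨⟨fun _ => by positivity, by simp⟩, fun a₁ a₂ h => le_of_eq ?_⟩
  have hfiber : ∑ f : A → Fin M with f a₁ = f a₂, (1 : ℝ) =
      Fintype.card ({a // a ≠ a₁} → Fin M) := by
    rw [Finset.sum_filter, ← (Equiv.funSplitAt a₁ (Fin M)).symm.sum_comp,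
      Fintype.sum_prod_type_right]
    simp [Equiv.funSplitAt, Equiv.piSplitAt, h.symm]
  have hcard : (Fintype.card (A → Fin M) : ℝ) = M * Fintype.card ({a // a ≠ a₁} → Fin M) := by
    rw [Fintype.card_congr (Equiv.funSplitAt a₁ (Fin M)), Fintype.card_prod, Fintype.card_fin,
      Nat.cast_mul]
  have hrest : (Fintype.card ({a // a ≠ a₁} → Fin M) : ℝ) ≠ 0 := by
    exact_mod_cast Fintype.card_ne_zero
  rw [← mul_one (Fintype.card (A → Fin M) : ℝ)⁻¹, ← Finset.mul_sum, hfiber, hcard]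
  field_simp

lemma log_one_add_le_rpow_div {x s : ℝ} (hx : 0 ≤ x) (hs : 0 < s) (hs1 : s ≤ 1) :
    Real.log (1 + x) ≤ x ^ s / s := by
  have hadd : (1 + x) ^ s ≤ 1 + x ^ s := by
    simpa using Real.rpow_add_le_add_rpow zero_le_one hx hs.le hs1
  have hxs : 0 ≤ x ^ s := Real.rpow_nonneg hx s
  rw [le_div_iff₀ hs, mul_comm]
  calc s * Real.log (1 + x) = Real.log ((1 + x) ^ s) := (Real.log_rpow (by linarith) s).symm
    _ ≤ Real.log (1 + x ^ s) := Real.log_le_log (by positivity) hadd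
    _ ≤ x ^ s := by linarith [Real.log_le_sub_one_of_pos (x := 1 + x ^ s) (by linarith)]

lemma sum_mul_log_one_add_le_rpow (hP : ∀ x, 0 ≤ P x) {M s : ℝ} (hM : 0 ≤ M) (hs : 0 < s)
    (hs1 : s ≤ 1) :
    ∑ x, P x * Real.log (1 + M * condProb P x) ≤ M ^ s / s * ∑ x, P x * condProb P x ^ s := by
  rw [Finset.mul_sum]
  refine Finset.sum_le_sum fun x _ => ?_
  have hc := condProb_nonneg hP x
  rw [mul_left_comm, div_mul_eq_mul_div, ← Real.mul_rpow hM hc]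
  exact mul_le_mul_of_nonneg_left (log_one_add_le_rpow_div (mul_nonneg hM hc) hs hs1) (hP x)

lemma exists_log_sub_condEntropy_le (hP : P ∈ stdSimplex ℝ (A × E)) {M : ℕ} (hM : 0 < M) {s : ℝ}
    (hs : 0 < s) (hs1 : s ≤ 1) :
    ∃ f : A → Fin M, Real.log M - condEntropy (hashDist P f) ≤
      (M : ℝ) ^ s / s * ∑ x, P x * condProb P x ^ s := by
  classical
  have : NeZero M := ⟨hM.ne'⟩
  have hq := isUniversalTwo_uniform A hM
  have havg := (sum_mul_log_sub_condEntropy_le hP hq).trans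
    (sum_mul_log_one_add_le_rpow hP.1 M.cast_nonneg hs hs1)
  rw [← one_mul ((M : ℝ) ^ s / s * _), ← hq.1.2, Finset.sum_mul] at havg
  obtain ⟨f, -, hf⟩ := Finset.exists_le_of_sum_le Finset.univ_nonempty havg
  exact ⟨f, le_of_mul_le_mul_left hf (by positivity)⟩

/-- Number of keys used at rate `R` and block length `n`. The added `1` keeps its logarithm
positive when `R = 0`. -/
noncomputable def keySize (R : ℝ) (n : ℕ) : ℕ := ⌈Real.exp (n * R)⌉₊ + 1

lemma exp_le_keySize (R : ℝ) (n : ℕ) : Real.exp (n * R) ≤ keySize R n := by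
  rw [keySize, Nat.cast_succ]
  linarith [Nat.le_ceil (Real.exp (n * R))]

lemma keySize_le_three_mul_exp {R : ℝ} (hR : 0 ≤ R) (n : ℕ) :
    (keySize R n : ℝ) ≤ 3 * Real.exp (n * R) := by
  have hone : 1 ≤ Real.exp (n * R) := Real.one_le_exp (by positivity)
  rw [keySize, Nat.cast_succ]
  linarith [Nat.ceil_lt_add_one (Real.exp_pos (n * R)).le]

lemma two_le_keySize (R : ℝ) (n : ℕ) : 2 ≤ keySize R n :=
  Nat.succ_le_succ (Nat.one_le_ceil_iff.2 (Real.exp_pos _))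

lemma tendsto_log_keySize_div {R : ℝ} (hR : 0 ≤ R) :
    Tendsto (fun n : ℕ => Real.log (keySize R n) / n) atTop (𝓝 R) := by
  have hup : Tendsto (fun n : ℕ => Real.log 3 / n + R) atTop (𝓝 R) := by
    simpa using (tendsto_const_div_atTop_nhds_zero_nat (Real.log 3)).add_const R
  refine tendsto_of_tendsto_of_tendsto_of_le_of_le' tendsto_const_nhds hup ?_ ?_
  all_goals
    filter_upwards [eventually_gt_atTop 0] with n hn
    have hn0 : (0 : ℝ) < n := by exact_mod_cast hn
    have hkey : (0 : ℝ) < keySize R n := (Real.exp_pos _).trans_le (exp_le_keySize R n)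
  · rw [le_div_iff₀ hn0, mul_comm, Real.le_log_iff_exp_le hkey]
    exact exp_le_keySize R n
  · rw [div_add' _ _ _ hn0.ne', mul_comm R, ← Real.log_exp (n * R),
      ← Real.log_mul three_ne_zero (Real.exp_pos _).ne']
    gcongr
    exact keySize_le_three_mul_exp hR n

lemma exists_hash_iidDist_le (hP : P ∈ stdSimplex ℝ (A × E)) {R s : ℝ} (hR : 0 ≤ R) (hs : 0 < s)
    (hs1 : s ≤ 1) (n : ℕ) :
    ∃ f : (Fin n → A) → Fin (keySize R n),
      Real.log (keySize R n) - condEntropy (hashDist (iidDist P n) f) ≤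
        3 ^ s / s * Real.exp (-(n * (renyiTilde P s - s * R))) := by
  obtain ⟨f, hf⟩ := exists_log_sub_condEntropy_le (iidDist_mem_stdSimplex hP n)
    (zero_lt_two.trans_le (two_le_keySize R n)) hs hs1
  refine ⟨f, hf.trans ?_⟩
  rw [sum_iidDist_mul_condProb_rpow hP.1]
  set Z := expMoment P (logCondProb P) s with hZ
  have hZ0 : 0 < Z := expMoment_pos _ hP s
  calc (keySize R n : ℝ) ^ s / s * Z ^ n
      ≤ (3 * Real.exp (n * R)) ^ s / s * Z ^ n := by
        gcongr
        exact keySize_le_three_mul_exp hR n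
    _ = 3 ^ s / s * (Real.exp (n * R) ^ s * Z ^ n) := by
        rw [Real.mul_rpow zero_le_three (Real.exp_pos _).le]
        ring
    _ = 3 ^ s / s * Real.exp (-(n * (renyiTilde P s - s * R))) := by
        rw [← Real.exp_mul, ← Real.exp_log hZ0, ← Real.exp_nat_mul, ← Real.exp_add,
          renyiTilde_eq_neg_log_expMoment hP.1 hs.le, ← hZ]
        ring_nf

lemma tendsto_entropy_margA_div_log {M : ℕ → ℕ} {F : ℕ → Type*} [∀ n, Fintype (F n)]
    {Q : ∀ n, Fin (M n) × F n → ℝ} (hQ : ∀ n, Q n ∈ stdSimplex ℝ (Fin (M n) × F n))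
    (hM : ∀ n, 2 ≤ M n) {b : ℕ → ℝ} (hb : Tendsto b atTop (𝓝 0))
    (hle : ∀ n, Real.log (M n) - condEntropy (Q n) ≤ b n) :
    Tendsto (fun n => entropy (margA (Q n)) / Real.log (M n)) atTop (𝓝 1) := by
  have hlog2 := Real.log_pos one_lt_two
  have hlim : Tendsto (fun n => 1 - b n / Real.log 2) atTop (𝓝 1) := by
    simpa using (hb.div_const (Real.log 2)).const_sub 1
  have hlogM (n : ℕ) : Real.log 2 ≤ Real.log (M n) :=
    Real.log_le_log two_pos (by exact_mod_cast hM n)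
  have hupper (n : ℕ) : entropy (margA (Q n)) ≤ Real.log (M n) := by
    simpa using entropy_le_log_card (margA_mem_stdSimplex (hQ n))
  refine tendsto_of_tendsto_of_tendsto_of_le_of_le hlim tendsto_const_nhds (fun n => ?_)
    fun n => div_le_one_of_le₀ (hupper n) (hlog2.trans_le (hlogM n)).le
  have hlower := condEntropy_le_entropy_margA (hQ n)
  have hb0 : 0 ≤ b n := by linarith [hupper n, hle n]
  have hpos : 0 < Real.log (M n) := hlog2.trans_le (hlogM n)
  calc 1 - b n / Real.log 2 ≤ 1 - b n / Real.log (M n) := by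
        gcongr
        exact_mod_cast hM n
    _ = (Real.log (M n) - b n) / Real.log (M n) := one_sub_div hpos.ne'
    _ ≤ entropy (margA (Q n)) / Real.log (M n) := by
        gcongr
        linarith [hle n]

lemma le_leakageExponent (hP : P ∈ stdSimplex ℝ (A × E)) {R s : ℝ} (hR : 0 ≤ R) (hs : 0 < s)
    (hs1 : s ≤ 1) (hpos : 0 < renyiTilde P s - s * R) :
    ((renyiTilde P s - s * R : ℝ) : EReal) ≤ leakageExponent P R := by
  choose f hf using exists_hash_iidDist_le hP hR hs hs1
  have hPn := iidDist_mem_stdSimplex hP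
  have hlim : Tendsto (fun n : ℕ => 3 ^ s / s * Real.exp (-(n * (renyiTilde P s - s * R))))
      atTop (𝓝 0) := by
    simpa using (tendsto_exp_neg_natCast_mul hpos).const_mul (3 ^ s / s)
  have hbound (n : ℕ) := (mutualInfo_hashDist_le (hPn n) (f n)).trans (hf n)
  exact (le_liminf_neg_log_div (by positivity) hbound).trans (le_sSup ⟨keySize R, f, R,
    tendsto_log_keySize_div hR, le_rfl, tendsto_entropy_margA_div_log
      (fun n => hashDist_mem_stdSimplex (hPn n) (f n)) (two_le_keySize R) hlim hf, rfl⟩)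

lemma renyiExponent_le_leakageExponent (hP : P ∈ stdSimplex ℝ (A × E)) {R : ℝ} (hR : 0 ≤ R)
    (hRH : R < condEntropy P) : (renyiExponent P R : EReal) ≤ leakageExponent P R := by
  have hpos := renyiExponent_pos hP hRH
  obtain ⟨s, ⟨h0, h1⟩, hs⟩ := (isGreatest_renyiExponent hP R).1
  simp only [mul_condRenyi_sub hP] at hs
  rw [← hs] at hpos ⊢
  refine le_leakageExponent hP hR (h0.lt_of_ne' ?_) h1 hpos
  rintro rfl
  simp [renyiTilde_zero hP] at hpos

end RandomHashing

end SmoothMinEntropy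

open SmoothMinEntropy in
theorem mainTheorem10 {A E : Type*} [Fintype A] [DecidableEq A] [Fintype E]
    (P : A × E → ℝ) (hP : P ∈ stdSimplex ℝ (A × E)) :
    (∀ (M : ℕ) (q : (A → Fin M) → ℝ), IsUniversalTwo q →
      expectedLeakage P q ≤ smoothLeakageBound P M) ∧
    ∀ R : ℝ, 0 ≤ R → R ≤ condEntropy P →
      ∃ W V : ℝ,
        IsLUB ((fun s : ℝ => s / (1 + s) * (condRenyi P s - R)) '' Set.Ici 0) W ∧
        IsGreatest ((fun s : ℝ => s * (condRenyi P s - R)) '' Set.Icc 0 1) V ∧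
        Tendsto (fun n : ℕ =>
            -(1 / (n : ℝ)) * Real.log (smoothLeakageBound (iidDist P n) (Real.exp (n * R))))
          atTop (𝓝 W) ∧
        (W : EReal) = (⨆ (R' : ℝ) (_ : R ≤ R'),
          min (⨆ (s : ℝ) (_ : 0 ≤ s), ((renyiTilde P s - s * R' : ℝ) : EReal))
            ((R' - R : ℝ) : EReal)) ∧
        (R < condEntropy P → (W : EReal) ≤ leakageExponent P R) ∧
        W ≤ V ∧
        (R < condEntropy P →
          (∃ x y : A × E, 0 < P x ∧ 0 < P y ∧ condProb P x ≠ condProb P y) → W < V) := by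
  refine ⟨fun M q hq => expectedLeakage_le_smoothLeakageBound hP hq, fun R hR hRH =>
    ⟨minEntropyExponent P R, renyiExponent P R, isLUB_minEntropyExponent hP R,
      isGreatest_renyiExponent hP R, tendsto_neg_log_smoothLeakageBound hP hR hRH,
      coe_minEntropyExponent hP R, fun hlt => ?_, minEntropyExponent_le_renyiExponent hP R, ?_⟩⟩
  · exact (EReal.coe_le_coe_iff.2 (minEntropyExponent_le_renyiExponent hP R)).trans
      (renyiExponent_le_leakageExponent hP hR hlt)
  · rintro hlt ⟨x, y, hx, hy, hxy⟩
    exact minEntropyExponent_lt_renyiExponent hP hlt hx hy hxy
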